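/- Let $1<p<2$, let $p^*=p/(p-1)$ be its Hölder conjugate, and write $\|x\|_q=(\sum_i|x_i|^q)^{1/q}$ for $x\in\mathbb R^n$. For $n\ge 1$ let $G_n$ be a random $n\times n$ matrix whose entries $g_{ij}$, $1\le i,j\le n$, are i.i.d. standard Gaussian random variables, and let $\xi_{p^*}=(\mathbb E|z|^{p^*})^{1/p^*}$ for a standard Gaussian random variable $z$. Let $\bar G_n=(G_n+G_n^T)/\sqrt2$, with entries $\bar g_{ij}$, let $e_1,\dots,e_n$ be the standard basis of $\mathbb R^n$, and define $v_i\in\mathbb R^n$ by $$v_i(j)=\mathrm{sgn}(\bar g_{ij})\Bigl(\frac{|\bar g_{ij}|^{p^*}}{\|\bar G_ne_i\|_{p^*}^{p^*}}\Bigr)^{1/p},\qquad 1\le j\le n,$$ where $\mathrm{sgn}(a)=1$ if $a\ge 0$ and $\mathrm{sgn}(a)=-1$ if $a<0$. Let $$\mathcal O=\Bigl\{\pm\frac{e_i+v_i}{\|e_i+v_i\|_p}:1\le i\le n\Bigr\},$$ with the convention that a quotient with denominator $0$ is $0$ (for $n\ge2$ this concerns only an event of probability $0$). (i) If the matrices $G_n$,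 $n\ge1$, are defined on a common probability space (with an arbitrary joint law for different $n$), then almost surely $$\lim_{n\to\infty}\frac1{n^{1/p^*}}\max_{\|x\|_p=1}\langle G_nx,x\rangle=2^{\frac12-\frac2p}\,\xi_{p^*}.$$ (ii) Each $x\in\mathcal O$ is a near optimizer in the following sense: for every $d>0$ there is a constant $C>0$, depending only on $p$ and $d$, such that for every $n\ge1$, with probability at least $1-Cn^{-d}$, $$\min_{x\in\mathcal O}\langle G_nx,x\rangle\ \ge\ 2^{\frac12-\frac2p}\,\xi_{p^*}\,n^{\frac1{p^*}}-C\Bigl(n^{-\frac1p+\frac12+\frac1{p^*}}(\log n)^{\frac{p^*}4}+\sqrt{\log n}\Bigr).$$ -/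

import Mathlib

open MeasureTheory ProbabilityTheory Filter
open scoped Topology Matrix

noncomputable section

namespace LpGrothendieck

/-- The `ℓ_p`-norm `(∑ i, |x_i| ^ p) ^ (1 / p)` of a vector of `ℝⁿ`, for finite `p`. -/
def normP (p : ℝ) {n : ℕ} (x : Fin n → ℝ) : ℝ := (∑ i, |x i| ^ p) ^ (1 / p)

/-- The unit sphere of the `ℓ_p`-norm in `ℝⁿ`. -/
def unitSphere (p : ℝ) (n : ℕ) : Set (Fin n → ℝ) := {x | normP p x = 1}

/-- The quadratic form `⟨A x, x⟩`. -/
def quadForm {n : ℕ} (A : Matrix (Fin n) (Fin n) ℝ) (x : Fin n → ℝ) : ℝ := (A *ᵥ x) ⬝ᵥ x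

/-- The maximum of `⟨A x, x⟩` over the `ℓ_p`-unit sphere. For `n ≥ 1` it is attained, see
`isGreatest_maxForm`. -/
def maxForm (p : ℝ) {n : ℕ} (A : Matrix (Fin n) (Fin n) ℝ) : ℝ :=
  sSup (quadForm A '' unitSphere p n)

/-- `ξ_q = (𝔼 |z| ^ q) ^ (1 / q)` for a standard Gaussian random variable `z`. -/
def xi (q : ℝ) : ℝ := (∫ z, |z| ^ q ∂(gaussianReal 0 1)) ^ (1 / q)

/-- The random `n × n` matrix `G` has i.i.d. standard Gaussian entries. -/
structure IsStdGaussianMatrix {Ω : Type*} [MeasurableSpace Ω] (μ : Measure Ω) {n : ℕ}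
    (G : Ω → Matrix (Fin n) (Fin n) ℝ) : Prop where
  measurable : ∀ i j, Measurable fun ω => G ω i j
  law : ∀ i j, μ.map (fun ω => G ω i j) = gaussianReal 0 1
  indep : iIndepFun (fun (ij : Fin n × Fin n) ω => G ω ij.1 ij.2) μ

/-- The symmetrized matrix `(A + Aᵀ) / √2`. -/
def symMatrix {n : ℕ} (A : Matrix (Fin n) (Fin n) ℝ) : Matrix (Fin n) (Fin n) ℝ :=
  (√2)⁻¹ • (A + Aᵀ)

/-- The sign, with value `1` at `0`. -/
def sgn (a : ℝ) : ℝ := if 0 ≤ a then 1 else -1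

/-- The standard basis vector `e_i`. -/
def basisVec {n : ℕ} (i : Fin n) : Fin n → ℝ := Pi.single i 1

/-- `v_i(j) = sgn(B_ij) (|B_ij| ^ p* / ‖B e_i‖_{p*} ^ p*) ^ (1 / p)` with `B = (A + Aᵀ) / √2`,
where `p* = p / (p - 1)`. -/
def optVec (p : ℝ) {n : ℕ} (A : Matrix (Fin n) (Fin n) ℝ) (i : Fin n) : Fin n → ℝ := fun j =>
  sgn (symMatrix A i j) *
    (|symMatrix A i j| ^ p.conjExponent /
      normP p.conjExponent (symMatrix A *ᵥ basisVec i) ^ p.conjExponent) ^ (1 / p)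

/-- The set `𝒪` of the `2n` vectors `± (e_i + v_i) / ‖e_i + v_i‖_p`. -/
def optSet (p : ℝ) {n : ℕ} (A : Matrix (Fin n) (Fin n) ℝ) : Set (Fin n → ℝ) :=
  {x | ∃ i : Fin n,
    x = (normP p (basisVec i + optVec p A i))⁻¹ • (basisVec i + optVec p A i) ∨
    x = -((normP p (basisVec i + optVec p A i))⁻¹ • (basisVec i + optVec p A i))}

theorem isGreatest_maxForm {p : ℝ} (hp : 1 ≤ p) {n : ℕ} (hn : 1 ≤ n)
    (A : Matrix (Fin n) (Fin n) ℝ) :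
    IsGreatest (quadForm A '' unitSphere p n) (maxForm p A) := by
  have hp0 : 0 < p := by linarith
  have hcont : Continuous fun x : Fin n → ℝ => normP p x := by
    unfold normP
    refine Continuous.rpow_const (continuous_finsetSum _ fun i _ => ?_) fun _ => Or.inr (by positivity)
    exact Continuous.rpow_const (by fun_prop) fun _ => Or.inr hp0.le
  have hclosed : IsClosed (unitSphere p n) := isClosed_eq hcont continuous_const
  have hsub : unitSphere p n ⊆ Metric.closedBall 0 1 := by
    intro x hx
    have hs : 0 ≤ ∑ i, |x i| ^ p := Finset.sum_nonneg fun i _ => by positivity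
    have h1 : ∑ i, |x i| ^ p = 1 := by
      have hx' : (∑ i, |x i| ^ p) ^ (1 / p) = 1 := hx
      have := congrArg (fun t : ℝ => t ^ p) hx'
      simpa [← Real.rpow_mul hs, hp0.ne'] using this
    rw [mem_closedBall_zero_iff, pi_norm_le_iff_of_nonneg zero_le_one]
    intro i
    have h2 : |x i| ^ p ≤ 1 := h1 ▸ Finset.single_le_sum (f := fun i => |x i| ^ p)
      (fun i _ => by positivity) (Finset.mem_univ i)
    by_contra! h
    exact absurd h2 (not_le.2 (Real.one_lt_rpow h hp0))
  have hcomp : IsCompact (unitSphere p n) :=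
    (isCompact_closedBall (0 : Fin n → ℝ) 1).of_isClosed_subset hclosed hsub
  have hne : (unitSphere p n).Nonempty := by
    refine ⟨basisVec ⟨0, hn⟩, ?_⟩
    have : ∀ i : Fin n, |basisVec ⟨0, hn⟩ i| ^ p = if i = ⟨0, hn⟩ then (1 : ℝ) else 0 := by
      intro i
      by_cases h : i = ⟨0, hn⟩ <;> simp [basisVec, h, hp0.ne']
    simp [unitSphere, normP, this]
  have hq : Continuous (quadForm A) := by
    unfold quadForm
    fun_prop
  exact (hcomp.image hq).isGreatest_sSup (hne.image _)

end LpGrothendieck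

end

/-!
Write `q = p*`, `Ḡ = (G + Gᵀ) / √2`, and `m = 𝔼|z|^q = ξ_q^q`.

Upper bound. Split a unit vector `x = u + w`, where `u` collects the coordinates exceeding
`n^(-a/p)` in absolute value (there are at most `n^a` of them) and `w` the flat rest. The term
`⟨Gu, u⟩` is negligible because `u` has few coordinates. The layer-cake formula writes `⟨Gw, w⟩`
as an average of bilinear forms in sign vectors, which a union bound controls all at once. For
the cross term `√2 ⟨Ḡu, w⟩`, the coordinates of `Ḡu` off the support of `u` are independent
Gaussians of variance `‖u‖₂² ≤ ‖u‖_p²`, so Hölder's inequality and a net of integer vectors bound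
it by `√2 ‖u‖_p ‖w‖_p (n (m + o(1)))^(1/q)`; finally `‖u‖_p ‖w‖_p ≤ 2^(-2/p)` because
`‖u‖_p^p + ‖w‖_p^p = 1`.

Lower bound. The vector `v_i` is the Hölder dual of the `i`-th row of `Ḡ`, so the cross term of
`e_i` and `v_i` is `√2 ‖Ḡe_i‖_q`. What remains is the quadratic form of `v_i` without its `i`-th
coordinate; conditionally on the `i`-th row and column of `G` it is Gaussian of variance at most
`1`, so it is `O(√log n)`. The row norms are controlled by the lower tail of sums of nonnegative
variables. The Borel–Cantelli lemma turns both bounds into the almost sure limit.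
-/

namespace LpGrothendieck

/-! ### Norms, sign vectors and the deterministic upper bound -/

section Norm

variable {n : ℕ} {p q : ℝ}

theorem normP_nonneg (p : ℝ) (x : Fin n → ℝ) : 0 ≤ normP p x :=
  Real.rpow_nonneg (Finset.sum_nonneg fun _ _ => by positivity) _

theorem normP_rpow (hp : p ≠ 0) (x : Fin n → ℝ) : normP p x ^ p = ∑ i, |x i| ^ p := by
  have hsum : 0 ≤ ∑ i, |x i| ^ p := Finset.sum_nonneg fun _ _ => by positivity
  rw [normP, ← Real.rpow_mul hsum, one_div_mul_cancel hp, Real.rpow_one]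

theorem normP_two_sq (x : Fin n → ℝ) : normP 2 x ^ 2 = ∑ i, x i ^ 2 := by
  simpa using normP_rpow two_ne_zero x

theorem normP_smul (hp : 0 < p) (c : ℝ) (x : Fin n → ℝ) : normP p (c • x) = |c| * normP p x := by
  have hsum : 0 ≤ ∑ i, |x i| ^ p := Finset.sum_nonneg fun _ _ => by positivity
  simp only [normP, Pi.smul_apply, smul_eq_mul, abs_mul,
    Real.mul_rpow (abs_nonneg _) (abs_nonneg _), ← Finset.mul_sum]
  rw [Real.mul_rpow (by positivity) hsum, ← Real.rpow_mul (abs_nonneg c), mul_one_div_cancel hp.ne',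
    Real.rpow_one]

theorem normP_mono (hp : 0 ≤ p) {x y : Fin n → ℝ} (h : ∀ i, |x i| ≤ |y i|) :
    normP p x ≤ normP p y := by
  refine Real.rpow_le_rpow (Finset.sum_nonneg fun _ _ => by positivity) ?_ (by positivity)
  exact Finset.sum_le_sum fun i _ => Real.rpow_le_rpow (abs_nonneg _) (h i) hp

theorem abs_apply_le_normP (hp : 0 < p) (x : Fin n → ℝ) (i : Fin n) : |x i| ≤ normP p x := by
  rw [← Real.rpow_le_rpow_iff (abs_nonneg _) (normP_nonneg p x) hp, normP_rpow hp.ne']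
  exact Finset.single_le_sum (f := fun i => |x i| ^ p) (fun _ _ => by positivity)
    (Finset.mem_univ i)

theorem normP_antitone_exponent (hp : 0 < p) (hpq : p ≤ q) (x : Fin n → ℝ) :
    normP q x ≤ normP p x := by
  have hq : 0 < q := hp.trans_le hpq
  have hpx := normP_nonneg p x
  rw [← Real.rpow_le_rpow_iff (normP_nonneg q x) hpx hq, normP_rpow hq.ne']
  have hsplit {a : ℝ} (ha : 0 ≤ a) : a ^ p * a ^ (q - p) = a ^ q := by
    rw [← Real.rpow_add_of_nonneg ha hp.le (sub_nonneg.2 hpq), add_sub_cancel]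
  calc ∑ i, |x i| ^ q ≤ ∑ i, |x i| ^ p * normP p x ^ (q - p) := by
        refine Finset.sum_le_sum fun i _ => ?_
        rw [← hsplit (abs_nonneg (x i))]
        gcongr
        exact abs_apply_le_normP hp x i
    _ = normP p x ^ q := by rw [← Finset.sum_mul, ← normP_rpow hp.ne', hsplit hpx]

theorem dotProduct_le_normP_mul_normP (hpq : p.HolderConjugate q) (x y : Fin n → ℝ) :
    x ⬝ᵥ y ≤ normP p x * normP q y :=
  Real.inner_le_Lp_mul_Lq _ x y hpq

theorem sum_abs_le_rpow_mul_normP (hpq : p.HolderConjugate q) {x : Fin n → ℝ} {k : ℕ}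
    (hk : hammingNorm x ≤ k) : ∑ i, |x i| ≤ (k : ℝ) ^ (1 / q) * normP p x := by
  classical
  set s : Finset (Fin n) := {i | x i ≠ 0} with hs
  have hzero (i) (hi : i ∉ s) : x i = 0 := by simpa [hs] using hi
  have holder := Real.inner_le_Lp_mul_Lq s (fun i => |x i|) (fun _ => 1) hpq
  simp only [mul_one, abs_abs, abs_one, Real.one_rpow, Finset.sum_const, nsmul_eq_mul] at holder
  have hsub (r : ℝ) (hr : r ≠ 0) : ∑ i ∈ s, |x i| ^ r = ∑ i, |x i| ^ r :=
    Finset.sum_subset (Finset.subset_univ s) fun i _ hi => by simp [hzero i hi, hr]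
  have hone := hsub 1 one_ne_zero
  simp only [Real.rpow_one] at hone
  rw [hsub p hpq.ne_zero] at holder
  rw [mul_comm, ← hone]
  refine holder.trans (mul_le_mul_of_nonneg_left ?_ (normP_nonneg p x))
  have hq := hpq.symm.pos
  gcongr
  exact hk

theorem sum_abs_le_rpow_of_normP_le_one (hpq : p.HolderConjugate q) {x : Fin n → ℝ}
    (hx : normP p x ≤ 1) : ∑ i, |x i| ≤ (n : ℝ) ^ (1 / q) := by
  refine (sum_abs_le_rpow_mul_normP hpq ?_).trans (mul_le_of_le_one_right (by positivity) hx)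
  simpa using hammingNorm_le_card_fintype (x := x)

theorem rpow_mul_card_le_abs_le (hp : 0 < p) (x : Fin n → ℝ) {t : ℝ} (ht : 0 ≤ t) :
    t ^ p * (Finset.card {i | t ≤ |x i|} : ℝ) ≤ normP p x ^ p := by
  rw [normP_rpow hp.ne']
  calc t ^ p * (Finset.card {i | t ≤ |x i|} : ℝ) = ∑ i with t ≤ |x i|, t ^ p := by simp [mul_comm]
    _ ≤ ∑ i with t ≤ |x i|, |x i| ^ p := Finset.sum_le_sum fun i hi =>
        Real.rpow_le_rpow ht (Finset.mem_filter.1 hi).2 hp.le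
    _ ≤ ∑ i, |x i| ^ p := Finset.sum_le_sum_of_subset_of_nonneg (Finset.filter_subset _ _)
        fun _ _ _ => by positivity

theorem normP_indicator_rpow_add (hp : p ≠ 0) (s : Set (Fin n)) (x : Fin n → ℝ) :
    normP p (s.indicator x) ^ p + normP p (sᶜ.indicator x) ^ p = normP p x ^ p := by
  classical
  simp only [normP_rpow hp, ← Finset.sum_add_distrib]
  refine Finset.sum_congr rfl fun i _ => ?_
  by_cases hi : i ∈ s <;> simp [hi, hp]

end Norm

theorem abs_dotProduct_mulVec_le {ι κ : Type*} [Fintype ι] [Fintype κ] {A : Matrix ι κ ℝ} {a : ℝ}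
    (hA : ∀ i j, |A i j| ≤ a) (x : ι → ℝ) (y : κ → ℝ) :
    |x ⬝ᵥ A *ᵥ y| ≤ a * (∑ i, |x i|) * ∑ j, |y j| := by
  simp only [dotProduct, Matrix.mulVec, Finset.mul_sum]
  calc |∑ i, ∑ j, x i * (A i j * y j)| ≤ ∑ i, ∑ j, |x i * (A i j * y j)| :=
        (Finset.abs_sum_le_sum_abs _ _).trans
          (Finset.sum_le_sum fun i _ => Finset.abs_sum_le_sum_abs _ _)
    _ ≤ ∑ i, ∑ j, a * |x i| * |y j| := by
        gcongr with i _ j _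
        rw [abs_mul, abs_mul, mul_left_comm, ← mul_assoc]
        gcongr
        exact hA i j
    _ = _ := by rw [Finset.sum_comm]; simp only [Finset.sum_mul]

section LayerCake

variable {n : ℕ} {p q : ℝ}

/-- The sign vector of the coordinates of `x` that are at least `t` in absolute value. The
layer-cake formula writes `x` as the integral of these vectors over `t > 0`. -/
noncomputable def levelSign (x : Fin n → ℝ) (t : ℝ) : Fin n → SignType :=
  fun i => if t ≤ |x i| then SignType.sign (x i) else 0

theorem coe_levelSign (x : Fin n → ℝ) (t : ℝ) (i : Fin n) :
    (levelSign x t i : ℝ) = {s | s ≤ |x i|}.indicator (fun _ => (SignType.sign (x i) : ℝ)) t := by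
  by_cases h : t ≤ |x i| <;> simp [levelSign, h]

theorem hammingNorm_levelSign (x : Fin n → ℝ) {t : ℝ} (ht : 0 < t) :
    hammingNorm (levelSign x t) = Finset.card {i | t ≤ |x i|} := by
  refine congrArg Finset.card (Finset.filter_congr fun i _ => ?_)
  have hne (h : t ≤ |x i|) : x i ≠ 0 := abs_pos.1 (ht.trans_le h)
  simpa [levelSign] using hne

theorem antitone_hammingNorm_levelSign (x : Fin n → ℝ) :
    Antitone fun t => (hammingNorm (levelSign x t) : ℝ) := by
  refine fun s t hst => Nat.cast_le.2 (Finset.card_mono ?_)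
  refine Finset.monotone_filter_right _ fun i _ => ?_
  simp only [levelSign]
  split_ifs <;> grind

theorem intervalIntegrable_hammingNorm_levelSign (x : Fin n → ℝ) (a b : ℝ) :
    IntervalIntegrable (fun t => (hammingNorm (levelSign x t) : ℝ)) volume a b :=
  (antitone_hammingNorm_levelSign x).intervalIntegrable

theorem intervalIntegrable_sqrt_hammingNorm_levelSign (x : Fin n → ℝ) (a b : ℝ) :
    IntervalIntegrable (fun t => √(hammingNorm (levelSign x t) : ℝ)) volume a b :=
  (Real.sqrt_monotone.comp_antitone (antitone_hammingNorm_levelSign x)).intervalIntegrable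

theorem dotProduct_eq_integral_levelSign (c : Fin n → ℝ) {x : Fin n → ℝ} {δ : ℝ}
    (hx : ∀ i, |x i| ≤ δ) :
    c ⬝ᵥ x = ∫ t in 0..δ, c ⬝ᵥ fun i => (levelSign x t i : ℝ) := by
  simp only [dotProduct, coe_levelSign]
  rw [intervalIntegral.integral_finsetSum fun i _ => ?_]
  · refine Finset.sum_congr rfl fun i _ => ?_
    rw [intervalIntegral.integral_const_mul,
      intervalIntegral.integral_indicator ⟨abs_nonneg _, hx i⟩]
    simp
  · exact ((intervalIntegrable_iff.2 ((integrableOn_const (by simp)).indicator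
      measurableSet_Iic))).const_mul _

theorem integral_hammingNorm_levelSign {x : Fin n → ℝ} {δ : ℝ} (hx : ∀ i, |x i| ≤ δ) :
    ∫ t in 0..δ, (hammingNorm (levelSign x t) : ℝ) = ∑ i, |x i| := by
  have hcard (t : ℝ) : (hammingNorm (levelSign x t) : ℝ) =
      (fun i => (SignType.sign (x i) : ℝ)) ⬝ᵥ fun i => (levelSign x t i : ℝ) := by
    rw [hammingNorm, Finset.card_filter, Nat.cast_sum]
    refine Finset.sum_congr rfl fun i _ => ?_
    rcases lt_trichotomy (x i) 0 with h | h | h <;> simp [levelSign, h] <;> split_ifs <;> simp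
  simp only [hcard]
  rw [← dotProduct_eq_integral_levelSign _ hx]
  exact Finset.sum_congr rfl fun i _ => sign_mul_self (x i)

theorem integral_sqrt_hammingNorm_levelSign_le (hp : 0 < p) (hp2 : p < 2) {x : Fin n → ℝ}
    (hx : normP p x ≤ 1) {δ : ℝ} (hδ : 0 ≤ δ) :
    ∫ t in 0..δ, √(hammingNorm (levelSign x t) : ℝ) ≤ δ ^ (1 - p / 2) / (1 - p / 2) := by
  have hpow : ∫ t in 0..δ, t ^ (-(p / 2)) = δ ^ (1 - p / 2) / (1 - p / 2) := by
    rw [integral_rpow (Or.inl (by linarith)), Real.zero_rpow (by linarith)]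
    ring_nf
  rw [← hpow]
  refine intervalIntegral.integral_mono_on_of_le_Ioo hδ
    (intervalIntegrable_sqrt_hammingNorm_levelSign _ _ _)
    (intervalIntegral.intervalIntegrable_rpow' (by linarith)) fun t ht => ?_
  have htp : 0 < t ^ p := Real.rpow_pos_of_pos ht.1 p
  have hmarkov : t ^ p * (hammingNorm (levelSign x t) : ℝ) ≤ 1 := by
    rw [hammingNorm_levelSign x ht.1]
    exact (rpow_mul_card_le_abs_le hp x ht.1.le).trans
      (Real.rpow_le_one (normP_nonneg p x) hx hp.le)
  have hsq : (t ^ (-(p / 2))) ^ 2 = (t ^ p)⁻¹ := by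
    rw [← Real.rpow_natCast, ← Real.rpow_mul ht.1.le, ← Real.rpow_neg ht.1.le]
    congr 1
    push_cast
    ring
  rw [Real.sqrt_le_left (Real.rpow_nonneg ht.1.le _), hsq, ← one_div, le_div_iff₀ htp]
  linarith

theorem abs_dotProduct_le_of_levelSign {c x : Fin n → ℝ} {δ : ℝ} (hδ : 0 ≤ δ)
    (hx : ∀ i, |x i| ≤ δ) {α β : ℝ}
    (hc : ∀ t, |c ⬝ᵥ fun i => (levelSign x t i : ℝ)| ≤
      α * √(hammingNorm (levelSign x t)) + β * hammingNorm (levelSign x t)) :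
    |c ⬝ᵥ x| ≤ α * (∫ t in 0..δ, √(hammingNorm (levelSign x t) : ℝ)) + β * ∑ i, |x i| := by
  have hsqrt := (intervalIntegrable_sqrt_hammingNorm_levelSign x 0 δ).const_mul α
  have hcard := (intervalIntegrable_hammingNorm_levelSign x 0 δ).const_mul β
  rw [dotProduct_eq_integral_levelSign c hx, ← integral_hammingNorm_levelSign hx,
    ← intervalIntegral.integral_const_mul, ← intervalIntegral.integral_const_mul,
    ← intervalIntegral.integral_add hsqrt hcard, ← Real.norm_eq_abs]
  exact intervalIntegral.norm_integral_le_of_norm_le hδ (ae_of_all _ fun t _ => hc t)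
    (hsqrt.add hcard)

/-- The bound `K (√|s| |t| + |s| √|t|)` for the bilinear form of `A` at sign vectors `s` and `t`
with `|s|` and `|t|` nonzero entries: the typical size of the maximum over all such pairs for a
Gaussian matrix, up to logarithms in `K`. -/
def SignFormBound (K : ℝ) (A : Matrix (Fin n) (Fin n) ℝ) : Prop :=
  ∀ s t : Fin n → SignType, |(fun i => (s i : ℝ)) ⬝ᵥ A *ᵥ fun i => (t i : ℝ)| ≤
    K * (√(hammingNorm s) * hammingNorm t + hammingNorm s * √(hammingNorm t))

theorem SignFormBound.abs_apply_le {K : ℝ} {A : Matrix (Fin n) (Fin n) ℝ}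
    (hA : SignFormBound K A) (i j : Fin n) : |A i j| ≤ 2 * K := by
  have hnorm (i : Fin n) : hammingNorm (Pi.single i 1 : Fin n → SignType) = 1 := by
    simp [hammingNorm, Pi.single_apply, Finset.filter_eq']
  have hcoe (i : Fin n) : (fun l => ((Pi.single i 1 : Fin n → SignType) l : ℝ)) =
      Pi.single i 1 := by
    ext l
    by_cases h : l = i <;> simp [h]
  have hij := hA (Pi.single i 1) (Pi.single j 1)
  simp only [hnorm, hcoe, Matrix.mulVec_single_one, single_one_dotProduct, Matrix.col_apply,
    Nat.cast_one, Real.sqrt_one] at hij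
  linarith

theorem SignFormBound.abs_dotProduct_mulVec_self_le (hpq : p.HolderConjugate q) (hp2 : p < 2)
    {K : ℝ} (hK : 0 ≤ K) {A : Matrix (Fin n) (Fin n) ℝ} (hA : SignFormBound K A)
    {x : Fin n → ℝ} (hx : normP p x ≤ 1) {δ : ℝ} (hδ : 0 ≤ δ) (hxδ : ∀ i, |x i| ≤ δ) :
    |x ⬝ᵥ A *ᵥ x| ≤ 2 * K * (δ ^ (1 - p / 2) / (1 - p / 2)) * (n : ℝ) ^ (1 / q) := by
  set a := ∫ t in 0..δ, √(hammingNorm (levelSign x t) : ℝ)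
  have hone (s : Fin n → SignType) : |(fun i => (s i : ℝ)) ⬝ᵥ A *ᵥ x| ≤
      K * hammingNorm s * a + K * √(hammingNorm s) * ∑ i, |x i| := by
    rw [Matrix.dotProduct_mulVec]
    refine abs_dotProduct_le_of_levelSign hδ hxδ fun t => ?_
    rw [← Matrix.dotProduct_mulVec]
    exact (hA s (levelSign x t)).trans_eq (by ring)
  have htwo : |x ⬝ᵥ A *ᵥ x| ≤ K * (∑ i, |x i|) * a + K * a * ∑ i, |x i| := by
    rw [dotProduct_comm]
    refine abs_dotProduct_le_of_levelSign hδ hxδ fun t => ?_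
    rw [dotProduct_comm]
    exact (hone (levelSign x t)).trans_eq (by ring)
  have ha0 : 0 ≤ a := intervalIntegral.integral_nonneg hδ fun t _ => by positivity
  have ha1 : a ≤ δ ^ (1 - p / 2) / (1 - p / 2) :=
    integral_sqrt_hammingNorm_levelSign_le hpq.pos hp2 hx hδ
  have hsum := sum_abs_le_rpow_of_normP_le_one hpq hx
  calc |x ⬝ᵥ A *ᵥ x| ≤ 2 * K * a * ∑ i, |x i| := htwo.trans_eq (by ring)
    _ ≤ 2 * K * (δ ^ (1 - p / 2) / (1 - p / 2)) * (n : ℝ) ^ (1 / q) := by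
        have := ha0.trans ha1
        gcongr

end LayerCake

section Rounding

variable {n : ℕ}

/-- The integer vector obtained by rounding `N • x` coordinatewise towards zero. -/
noncomputable def gridRound (N : ℕ) (x : Fin n → ℝ) : Fin n → ℤ :=
  fun i => SignType.sign (x i) * ⌊N * |x i|⌋

theorem gridRound_eq_zero {N : ℕ} {x : Fin n → ℝ} {i : Fin n} (h : x i = 0) :
    gridRound N x i = 0 := by
  simp [gridRound, h]

theorem hammingNorm_gridRound_le (N : ℕ) (x : Fin n → ℝ) :
    hammingNorm (gridRound N x) ≤ hammingNorm x :=
  Finset.card_le_card <| Finset.monotone_filter_right _ fun _ _ hi h => hi (gridRound_eq_zero h)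

theorem coe_gridRound (N : ℕ) (x : Fin n → ℝ) (i : Fin n) :
    (gridRound N x i : ℝ) = SignType.sign (x i) * (⌊N * |x i|⌋ : ℝ) := by
  rcases lt_trichotomy (x i) 0 with h | h | h <;> simp [gridRound, h]

theorem abs_sign_le_one (a : ℝ) : |(SignType.sign a : ℝ)| ≤ 1 := by
  rcases lt_trichotomy a 0 with h | h | h <;> simp [h]

theorem abs_gridRound_le (N : ℕ) (x : Fin n → ℝ) (i : Fin n) :
    |(gridRound N x i : ℝ)| ≤ N * |x i| := by
  have hfloor : (0 : ℝ) ≤ ⌊N * |x i|⌋ := by positivity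
  rw [coe_gridRound, abs_mul, abs_of_nonneg hfloor]
  exact (mul_le_of_le_one_left hfloor (abs_sign_le_one _)).trans (Int.floor_le _)

theorem abs_mul_sub_gridRound_le (N : ℕ) (x : Fin n → ℝ) (i : Fin n) :
    |N * x i - gridRound N x i| ≤ 1 := by
  have hfract : N * x i - gridRound N x i = SignType.sign (x i) * Int.fract (N * |x i|) := by
    rw [coe_gridRound, Int.fract, mul_sub, mul_left_comm, sign_mul_abs]
  rw [hfract, abs_mul, Int.abs_fract]
  exact mul_le_one₀ (abs_sign_le_one _) (Int.fract_nonneg _) (Int.fract_lt_one _).le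

theorem sum_abs_mul_sub_gridRound_le (N : ℕ) {x : Fin n → ℝ} {k : ℕ} (hk : hammingNorm x ≤ k) :
    ∑ i, |N * x i - gridRound N x i| ≤ k := by
  have hi (i : Fin n) : |N * x i - gridRound N x i| ≤ if x i ≠ 0 then 1 else 0 := by
    split_ifs with h
    · exact abs_mul_sub_gridRound_le N x i
    · simp [gridRound_eq_zero, not_not.1 h]
  calc ∑ i, |N * x i - gridRound N x i| ≤ ∑ i, if x i ≠ 0 then (1 : ℝ) else 0 :=
        Finset.sum_le_sum fun i _ => hi i
    _ = hammingNorm x := by rw [hammingNorm, Finset.natCast_card_filter]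
    _ ≤ k := by exact_mod_cast hk

end Rounding

section UpperBound

variable {n : ℕ} {p q K L : ℝ} {N k : ℕ}

/-- On integer vectors `z` with at most `k` nonzero coordinates, all of size at most `N`, the part
of `B z` outside the support of `z` has `ℓ_q`-norm at most `L ‖z‖₂`. -/
def SparseImageBound (q L : ℝ) (N k : ℕ) (B : Matrix (Fin n) (Fin n) ℝ) : Prop :=
  ∀ z : Fin n → ℤ, (∀ i, |z i| ≤ N) → hammingNorm z ≤ k →
    normP q ({j | z j = 0}.indicator (B *ᵥ fun i => (z i : ℝ))) ≤
      L * normP 2 fun i => (z i : ℝ)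

theorem SparseImageBound.dotProduct_mulVec_gridRound_le {B : Matrix (Fin n) (Fin n) ℝ}
    (hB : SparseImageBound q L N k B) (hL : 0 ≤ L) (hpq : p.HolderConjugate q) (hp2 : p ≤ 2)
    {u w : Fin n → ℝ} (huw : ∀ i, u i = 0 ∨ w i = 0) (hu : normP p u ≤ 1)
    (huk : hammingNorm u ≤ k) :
    w ⬝ᵥ B *ᵥ (fun i => (gridRound N u i : ℝ)) ≤ N * (L * (normP p u * normP p w)) := by
  set z := gridRound N u
  have hbox (i : Fin n) : |z i| ≤ N := by
    have hi : |u i| ≤ 1 := (abs_apply_le_normP hpq.pos u i).trans hu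
    exact_mod_cast (abs_gridRound_le N u i).trans (mul_le_of_le_one_right (by positivity) hi)
  have hnorm : normP 2 (fun i => (z i : ℝ)) ≤ N * normP p u := by
    calc normP 2 (fun i => (z i : ℝ)) ≤ normP 2 ((N : ℝ) • u) :=
          normP_mono zero_le_two fun i => by simpa [abs_mul] using abs_gridRound_le N u i
      _ ≤ N * normP p u := by
          rw [normP_smul two_pos, Nat.abs_cast]
          gcongr
          exact normP_antitone_exponent hpq.pos hp2 u
  have hoff (y : Fin n → ℝ) : w ⬝ᵥ y = w ⬝ᵥ {j | z j = 0}.indicator y := by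
    refine Finset.sum_congr rfl fun i _ => ?_
    rcases huw i with h | h
    · simp [z, gridRound_eq_zero h]
    · simp [h]
  calc w ⬝ᵥ B *ᵥ (fun i => (z i : ℝ))
      ≤ normP p w * normP q ({j | z j = 0}.indicator (B *ᵥ fun i => (z i : ℝ))) := by
        rw [hoff]
        exact dotProduct_le_normP_mul_normP hpq _ _
    _ ≤ normP p w * (L * (N * normP p u)) := by
        refine mul_le_mul_of_nonneg_left ?_ (normP_nonneg p w)
        exact (hB z hbox ((hammingNorm_gridRound_le N u).trans huk)).trans (by gcongr)
    _ = N * (L * (normP p u * normP p w)) := by ring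

theorem SparseImageBound.dotProduct_mulVec_le {B : Matrix (Fin n) (Fin n) ℝ} {a : ℝ}
    (hB : SparseImageBound q L N k B) (hL : 0 ≤ L) (hN : 1 ≤ N) (ha : ∀ i j, |B i j| ≤ a)
    (hpq : p.HolderConjugate q) (hp2 : p ≤ 2) {u w : Fin n → ℝ} (huw : ∀ i, u i = 0 ∨ w i = 0)
    (hu : normP p u ≤ 1) (huk : hammingNorm u ≤ k) :
    w ⬝ᵥ B *ᵥ u ≤ L * (normP p u * normP p w) + a * (∑ i, |w i|) * (k / N) := by
  have hN0 : (0 : ℝ) < N := by exact_mod_cast hN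
  set z : Fin n → ℝ := fun i => gridRound N u i
  have herror : w ⬝ᵥ B *ᵥ ((N : ℝ) • u - z) ≤ a * (∑ i, |w i|) * k := by
    rcases isEmpty_or_nonempty (Fin n) with h | ⟨⟨i⟩⟩
    · simp
    have ha0 : 0 ≤ a := (abs_nonneg _).trans (ha i i)
    refine (le_abs_self _).trans ((abs_dotProduct_mulVec_le ha _ _).trans ?_)
    gcongr
    exact sum_abs_mul_sub_gridRound_le N huk
  have hscaled : N * (w ⬝ᵥ B *ᵥ u) ≤
      N * (L * (normP p u * normP p w)) + a * (∑ i, |w i|) * k := by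
    calc N * (w ⬝ᵥ B *ᵥ u) = w ⬝ᵥ B *ᵥ z + w ⬝ᵥ B *ᵥ ((N : ℝ) • u - z) := by
          rw [← dotProduct_add, ← Matrix.mulVec_add, add_sub_cancel, Matrix.mulVec_smul,
            dotProduct_smul, smul_eq_mul]
      _ ≤ _ := add_le_add (hB.dotProduct_mulVec_gridRound_le hL hpq hp2 huw hu huk) herror
  refine le_of_mul_le_mul_left (hscaled.trans_eq ?_) hN0
  field_simp

theorem quadForm_eq_dotProduct (A : Matrix (Fin n) (Fin n) ℝ) (x : Fin n → ℝ) :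
    quadForm A x = x ⬝ᵥ A *ᵥ x :=
  dotProduct_comm _ _

theorem quadForm_add (A : Matrix (Fin n) (Fin n) ℝ) (u w : Fin n → ℝ) :
    quadForm A (u + w) = quadForm A u + quadForm A w + √2 * (w ⬝ᵥ symMatrix A *ᵥ u) := by
  have hcross : √2 * (w ⬝ᵥ symMatrix A *ᵥ u) = w ⬝ᵥ A *ᵥ u + u ⬝ᵥ A *ᵥ w := by
    rw [symMatrix, Matrix.smul_mulVec, dotProduct_smul, smul_eq_mul,
      mul_inv_cancel_left₀ (by positivity), Matrix.add_mulVec, dotProduct_add,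
      Matrix.mulVec_transpose, dotProduct_comm w (u ᵥ* A), ← Matrix.dotProduct_mulVec]
  rw [hcross]
  simp only [quadForm_eq_dotProduct, Matrix.mulVec_add, dotProduct_add, add_dotProduct]
  ring

theorem mul_le_of_rpow_add_rpow_le_one (hp : 0 < p) {a b : ℝ} (ha : 0 ≤ a) (hb : 0 ≤ b)
    (h : a ^ p + b ^ p ≤ 1) : a * b ≤ 2 ^ (-(2 / p)) := by
  have hpow : (2 ^ (-(2 / p)) : ℝ) ^ p = 1 / 4 := by
    rw [← Real.rpow_mul zero_le_two, neg_mul, div_mul_cancel₀ _ hp.ne']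
    norm_num [Real.rpow_neg]
  rw [← Real.rpow_le_rpow_iff (by positivity) (by positivity) hp, hpow, Real.mul_rpow ha hb]
  have := Real.rpow_nonneg ha p
  have := Real.rpow_nonneg hb p
  nlinarith [sq_nonneg (a ^ p - b ^ p)]

theorem hammingNorm_indicator_lt_abs_le (hp : 0 < p) {x : Fin n → ℝ} (hx : normP p x ≤ 1) {δ : ℝ}
    (hδ : 0 < δ) : (hammingNorm ({i | δ < |x i|}.indicator x) : ℝ) ≤ δ ^ (-p) := by
  classical
  have hδp : 0 < δ ^ p := Real.rpow_pos_of_pos hδ p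
  have hsub : hammingNorm ({i | δ < |x i|}.indicator x) ≤ Finset.card {i | δ ≤ |x i|} := by
    refine Finset.card_le_card (Finset.monotone_filter_right _ fun i _ hi => ?_)
    exact (Set.mem_of_indicator_ne_zero hi).le
  rw [Real.rpow_neg hδ.le, ← one_div, le_div_iff₀' hδp]
  calc _ ≤ δ ^ p * (Finset.card {i | δ ≤ |x i|} : ℝ) := by gcongr
    _ ≤ normP p x ^ p := rpow_mul_card_le_abs_le hp x hδ.le
    _ ≤ 1 := Real.rpow_le_one (normP_nonneg p x) hx hp.le

theorem SignFormBound.nonneg {A : Matrix (Fin n) (Fin n) ℝ} (hA : SignFormBound K A)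
    (hn : 1 ≤ n) : 0 ≤ K := by
  have := (abs_nonneg _).trans (hA.abs_apply_le ⟨0, hn⟩ ⟨0, hn⟩)
  linarith

theorem SignFormBound.abs_symMatrix_apply_le {A : Matrix (Fin n) (Fin n) ℝ}
    (hA : SignFormBound K A) (i j : Fin n) : |symMatrix A i j| ≤ 2 * √2 * K := by
  have h2 : (√2)⁻¹ * 4 = 2 * √2 := by
    field_simp
    norm_num
  calc |symMatrix A i j| = (√2)⁻¹ * |A i j + A j i| := by
        simp [symMatrix, abs_mul]
    _ ≤ (√2)⁻¹ * (2 * K + 2 * K) := by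
        gcongr
        exact (abs_add_le _ _).trans (add_le_add (hA.abs_apply_le i j) (hA.abs_apply_le j i))
    _ = 2 * √2 * K := by rw [← h2]; ring

theorem SignFormBound.quadForm_le_of_hammingNorm_le (hpq : p.HolderConjugate q) (hK : 0 ≤ K)
    {A : Matrix (Fin n) (Fin n) ℝ} (hA : SignFormBound K A) {u : Fin n → ℝ} (hu : normP p u ≤ 1)
    (huk : hammingNorm u ≤ k) : quadForm A u ≤ 2 * K * (k : ℝ) ^ (2 / q) := by
  have hsum : ∑ i, |u i| ≤ (k : ℝ) ^ (1 / q) :=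
    (sum_abs_le_rpow_mul_normP hpq huk).trans (mul_le_of_le_one_right (by positivity) hu)
  rw [quadForm_eq_dotProduct, show 2 / q = 1 / q + 1 / q by ring,
    Real.rpow_add_of_nonneg (by positivity) hpq.symm.one_div_nonneg hpq.symm.one_div_nonneg,
    ← mul_assoc]
  refine (le_abs_self _).trans ((abs_dotProduct_mulVec_le hA.abs_apply_le u u).trans ?_)
  gcongr

theorem SignFormBound.quadForm_le (hpq : p.HolderConjugate q) (hp2 : p < 2) (hn : 1 ≤ n)
    (hN : 1 ≤ N) (hL : 0 ≤ L) {A : Matrix (Fin n) (Fin n) ℝ} (hA : SignFormBound K A)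
    (hB : SparseImageBound q L N k (symMatrix A)) {δ : ℝ} (hδ : 0 < δ) (hk : δ ^ (-p) ≤ k)
    {x : Fin n → ℝ} (hx : normP p x = 1) :
    quadForm A x ≤ √2 * 2 ^ (-(2 / p)) * L + 2 * K * (k : ℝ) ^ (2 / q) +
      2 * K * (δ ^ (1 - p / 2) / (1 - p / 2)) * (n : ℝ) ^ (1 / q) +
      4 * K * (k / N) * (n : ℝ) ^ (1 / q) := by
  classical
  have hp := hpq.pos
  have hK := hA.nonneg hn
  set S : Set (Fin n) := {i | δ < |x i|}
  set u := S.indicator x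
  set w := Sᶜ.indicator x
  have hu : normP p u ≤ 1 := hx ▸ normP_mono hp.le fun i => by
    by_cases hi : i ∈ S <;> simp [u, hi]
  have hw : normP p w ≤ 1 := hx ▸ normP_mono hp.le fun i => by
    by_cases hi : i ∈ S <;> simp [w, hi]
  have huk : hammingNorm u ≤ k := by
    exact_mod_cast (hammingNorm_indicator_lt_abs_le hp hx.le hδ).trans hk
  have hsparse := hA.quadForm_le_of_hammingNorm_le hpq hK hu huk
  have hflat : quadForm A w ≤ 2 * K * (δ ^ (1 - p / 2) / (1 - p / 2)) * (n : ℝ) ^ (1 / q) := by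
    rw [quadForm_eq_dotProduct]
    refine (le_abs_self _).trans (hA.abs_dotProduct_mulVec_self_le hpq hp2 hK hw hδ.le fun i => ?_)
    by_cases hi : i ∈ S
    · simp [w, hi, hδ.le]
    · simpa [w, hi] using not_lt.1 hi
  have hcross : w ⬝ᵥ symMatrix A *ᵥ u ≤
      L * 2 ^ (-(2 / p)) + 2 * √2 * K * (n : ℝ) ^ (1 / q) * (k / N) := by
    have hdisj (i : Fin n) : u i = 0 ∨ w i = 0 := by
      by_cases hi : i ∈ S <;> simp [u, w, hi]
    refine (hB.dotProduct_mulVec_le hL hN hA.abs_symMatrix_apply_le hpq hp2.le hdisj hu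
      huk).trans ?_
    gcongr
    · refine mul_le_of_rpow_add_rpow_le_one hp (normP_nonneg p u) (normP_nonneg p w) ?_
      rw [normP_indicator_rpow_add hp.ne', hx, Real.one_rpow]
    · exact sum_abs_le_rpow_of_normP_le_one hpq hw
  have hx' : x = u + w := (Set.indicator_self_add_compl S x).symm
  have h2 : √2 * √2 = 2 := Real.mul_self_sqrt zero_le_two
  rw [hx', quadForm_add]
  have := mul_le_mul_of_nonneg_left hcross (Real.sqrt_nonneg 2)
  linear_combination hsparse + hflat + this + 2 * K * (n : ℝ) ^ (1 / q) * (k / N) * h2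

end UpperBound

/-! ### Gaussian families -/

/-- A family of i.i.d. standard Gaussian random variables. -/
structure IsStdGaussianFamily {Ω ι : Type*} [MeasurableSpace Ω] (μ : Measure Ω)
    (X : ι → Ω → ℝ) : Prop where
  measurable : ∀ i, Measurable (X i)
  law : ∀ i, μ.map (X i) = gaussianReal 0 1
  indep : iIndepFun X μ

/-- The moment `𝔼 |z| ^ q` of a standard Gaussian random variable `z`, so that
`xi q = gaussMoment q ^ (1 / q)`. -/
noncomputable def gaussMoment (q : ℝ) : ℝ := ∫ z, |z| ^ q ∂(gaussianReal 0 1)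

theorem integrable_abs_rpow_gaussianReal {q : ℝ} (hq : 0 ≤ q) :
    Integrable (fun z : ℝ => |z| ^ q) (gaussianReal 0 1) := by
  have h : (0 : ℝ) ∈ interior (integrableExpSet id (gaussianReal 0 1)) := by simp
  exact integrable_rpow_abs_of_mem_interior_integrableExpSet h hq

theorem gaussMoment_pos {q : ℝ} (hq : 0 ≤ q) : 0 < gaussMoment q := by
  unfold gaussMoment
  rw [integral_pos_iff_support_of_nonneg (fun z => by positivity)
    (integrable_abs_rpow_gaussianReal hq)]
  have : NullSingletonClass (gaussianReal 0 1) := nullSingletonClass_gaussianReal one_ne_zero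
  have h1 : ({0}ᶜ : Set ℝ) ⊆ Function.support fun z : ℝ => |z| ^ q := fun z hz =>
    (Real.rpow_pos_of_pos (abs_pos.2 hz) q).ne'
  refine lt_of_lt_of_le ?_ (measure_mono h1)
  rw [prob_compl_eq_one_sub (measurableSet_singleton 0), measure_singleton]
  simp

theorem hasSubgaussianMGF_mono {Ω : Type*} [MeasurableSpace Ω] {μ : Measure Ω} {X : Ω → ℝ}
    {c d : NNReal} (h : HasSubgaussianMGF X c μ) (hcd : c ≤ d) : HasSubgaussianMGF X d μ :=
  ⟨h.integrable_exp_mul, fun t => (h.mgf_le t).trans (Real.exp_le_exp.2 (by gcongr))⟩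

theorem exp_neg_le_quadratic {x : ℝ} (hx : 0 ≤ x) : Real.exp (-x) ≤ 1 - x + x ^ 2 / 2 := by
  rw [Real.exp_neg]
  refine (inv_anti₀ (by positivity) (Real.quadratic_le_exp_of_nonneg hx)).trans ?_
  rw [inv_le_iff_one_le_mul₀ (by positivity)]
  nlinarith [sq_nonneg (x ^ 2)]

section Nonneg

variable {Ω ι : Type*} [MeasurableSpace Ω] {μ : Measure Ω} [IsProbabilityMeasure μ]

theorem integrable_exp_neg_mul_of_nonneg {Y : Ω → ℝ} (hY : Measurable Y) (h0 : ∀ ω, 0 ≤ Y ω)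
    {τ : ℝ} (hτ : 0 ≤ τ) : Integrable (fun ω => Real.exp (-τ * Y ω)) μ := by
  refine Integrable.of_bound (C := 1) (hY.const_mul _).exp.aestronglyMeasurable
    (ae_of_all _ fun ω => ?_)
  rw [Real.norm_of_nonneg (Real.exp_pos _).le, Real.exp_le_one_iff, neg_mul]
  exact neg_nonpos.2 (mul_nonneg hτ (h0 ω))

theorem mgf_neg_le_of_nonneg {Y : Ω → ℝ} (hY : Measurable Y) (h0 : ∀ ω, 0 ≤ Y ω)
    (hL2 : MemLp Y 2 μ) {τ : ℝ} (hτ : 0 ≤ τ) :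
    mgf Y μ (-τ) ≤ Real.exp (-τ * ∫ ω, Y ω ∂μ + τ ^ 2 * (∫ ω, Y ω ^ 2 ∂μ) / 2) := by
  have hi1 : Integrable (fun ω => τ * Y ω) μ := (hL2.integrable one_le_two).const_mul τ
  have hi2 : Integrable (fun ω => τ ^ 2 / 2 * Y ω ^ 2) μ := hL2.integrable_sq.const_mul _
  have hi3 : Integrable (fun ω => 1 - τ * Y ω) μ := (integrable_const 1).sub hi1
  calc mgf Y μ (-τ) ≤ ∫ ω, (1 - τ * Y ω + τ ^ 2 / 2 * Y ω ^ 2) ∂μ := by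
        refine integral_mono (integrable_exp_neg_mul_of_nonneg hY h0 hτ) (hi3.add hi2)
          fun ω => ?_
        have h := exp_neg_le_quadratic (mul_nonneg hτ (h0 ω))
        simp only [neg_mul]
        linarith
    _ = (-τ * ∫ ω, Y ω ∂μ + τ ^ 2 * (∫ ω, Y ω ^ 2 ∂μ) / 2) + 1 := by
        rw [integral_add hi3 hi2, integral_sub (integrable_const 1) hi1, integral_const_mul,
          integral_const_mul, integral_const, probReal_univ, one_smul]
        ring
    _ ≤ _ := Real.add_one_le_exp _

theorem measureReal_sum_le_sum_integral_sub_le [Fintype ι] {Y : ι → Ω → ℝ}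
    (hind : iIndepFun Y μ) (hY : ∀ i, Measurable (Y i)) (h0 : ∀ i ω, 0 ≤ Y i ω)
    (hL2 : ∀ i, MemLp (Y i) 2 μ) {V s : ℝ} (hV0 : 0 < V) (hV : ∑ i, ∫ ω, Y i ω ^ 2 ∂μ ≤ V)
    (hs : 0 ≤ s) :
    μ.real {ω | ∑ i, Y i ω ≤ ∑ i, ∫ ω, Y i ω ∂μ - s} ≤ Real.exp (-s ^ 2 / (2 * V)) := by
  have hτ : 0 ≤ s / V := by positivity
  have hmgf : mgf (fun ω => ∑ i, Y i ω) μ (-(s / V)) ≤ Real.exp (-(s / V) *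
      ∑ i, ∫ ω, Y i ω ∂μ + (s / V) ^ 2 * (∑ i, ∫ ω, Y i ω ^ 2 ∂μ) / 2) := by
    rw [← Finset.sum_fn, hind.mgf_sum hY, Finset.mul_sum, Finset.mul_sum, Finset.sum_div,
      ← Finset.sum_add_distrib, Real.exp_sum]
    exact Finset.prod_le_prod (fun i _ => mgf_nonneg) fun i _ =>
      mgf_neg_le_of_nonneg (hY i) (h0 i) (hL2 i) hτ
  have hint := integrable_exp_neg_mul_of_nonneg (μ := μ)
    (Finset.measurable_fun_sum Finset.univ fun i _ => hY i)
    (fun ω => Finset.sum_nonneg fun i _ => h0 i ω) hτ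
  refine (measure_le_le_exp_mul_mgf _ (neg_nonpos.2 hτ) hint).trans ?_
  refine (mul_le_mul_of_nonneg_left hmgf (Real.exp_pos _).le).trans ?_
  rw [← Real.exp_add, Real.exp_le_exp]
  calc _ = -(s / V) * s + (s / V) ^ 2 * (∑ i, ∫ ω, Y i ω ^ 2 ∂μ) / 2 := by ring
    _ ≤ -(s / V) * s + (s / V) ^ 2 * V / 2 := by gcongr
    _ = -s ^ 2 / (2 * V) := by
        field_simp
        ring

end Nonneg

section Family

variable {Ω ι : Type*} [MeasurableSpace Ω] {μ : Measure Ω} {X : ι → Ω → ℝ}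

theorem IsStdGaussianFamily.hasGaussianLaw (h : IsStdGaussianFamily μ X) (i : ι) :
    HasGaussianLaw (X i) μ where
  isGaussian_map := by rw [h.law]; infer_instance

theorem IsStdGaussianFamily.hasSubgaussianMGF (h : IsStdGaussianFamily μ X) (i : ι) :
    HasSubgaussianMGF (X i) 1 μ where
  integrable_exp_mul t := by
    have := integrable_exp_mul_gaussianReal (μ := 0) (v := 1) t
    rw [← h.law i, integrable_map_measure (by fun_prop) (h.measurable i).aemeasurable] at this
    exact this
  mgf_le t := by rw [mgf_gaussianReal (h.law i)]; simp

theorem IsStdGaussianFamily.integral_comp (h : IsStdGaussianFamily μ X) (i : ι) {f : ℝ → ℝ}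
    (hf : Measurable f) : ∫ ω, f (X i ω) ∂μ = ∫ z, f z ∂(gaussianReal 0 1) := by
  rw [← h.law i, integral_map (h.measurable i).aemeasurable hf.aestronglyMeasurable]

theorem IsStdGaussianFamily.integrable_comp (h : IsStdGaussianFamily μ X) (i : ι) {f : ℝ → ℝ}
    (hf : Measurable f) (hi : Integrable f (gaussianReal 0 1)) :
    Integrable (fun ω => f (X i ω)) μ := by
  rw [← h.law i, integrable_map_measure hf.aestronglyMeasurable (h.measurable i).aemeasurable] at hi
  exact hi

theorem IsStdGaussianFamily.covariance [DecidableEq ι] (h : IsStdGaussianFamily μ X) (i j : ι) :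
    cov[X i, X j; μ] = if i = j then 1 else 0 := by
  split_ifs with hij
  · subst hij
    rw [covariance_self (h.measurable i).aemeasurable]
    have := (h.hasGaussianLaw i).isProbabilityMeasure
    have h1 : HasLaw (X i) (gaussianReal 0 1) μ := ⟨(h.measurable i).aemeasurable, h.law i⟩
    rw [h1.variance_eq, variance_id_gaussianReal]
    simp
  · exact (h.indep.indepFun hij).covariance_eq_zero (h.hasGaussianLaw i).memLp_two
      (h.hasGaussianLaw j).memLp_two

theorem IsStdGaussianFamily.hasGaussianLaw_linearForms [Fintype ι] {κ : Type*} [Finite κ]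
    (h : IsStdGaussianFamily μ X) (c : κ → ι → ℝ) :
    HasGaussianLaw (fun ω k => ∑ i, c k i * X i ω) μ := by
  cases nonempty_fintype κ
  let L : (ι → ℝ) →L[ℝ] (κ → ℝ) :=
    ContinuousLinearMap.pi fun k => ∑ i, c k i • ContinuousLinearMap.proj i
  have hL : (fun ω k => ∑ i, c k i * X i ω) = fun ω => L (X · ω) := by
    ext ω k
    simp [L]
  rw [hL]
  exact (h.indep.hasGaussianLaw h.hasGaussianLaw).map_fun L

theorem IsStdGaussianFamily.linearForms [Fintype ι] {κ : Type*} [Finite κ] [DecidableEq κ]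
    (h : IsStdGaussianFamily μ X) (c : κ → ι → ℝ)
    (hc : ∀ k l, ∑ i, c k i * c l i = if k = l then 1 else 0) :
    IsStdGaussianFamily μ (fun k ω => ∑ i, c k i * X i ω) := by
  classical
  cases nonempty_fintype κ
  have := h.indep.isProbabilityMeasure
  have hcov (k l : κ) : cov[fun ω => ∑ i, c k i * X i ω, fun ω => ∑ i, c l i * X i ω; μ] =
      if k = l then 1 else 0 := by
    rw [covariance_fun_sum_fun_sum (fun i => (h.hasGaussianLaw i).memLp_two.const_mul _)
      (fun i => (h.hasGaussianLaw i).memLp_two.const_mul _)]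
    simp only [covariance_const_mul_left, covariance_const_mul_right, h.covariance]
    simp [← hc k l, mul_comm]
  have hlaw := h.hasGaussianLaw_linearForms c
  have hmeas (k : κ) : Measurable fun ω => ∑ i, c k i * X i ω :=
    Finset.measurable_fun_sum _ fun i _ => (h.measurable i).const_mul _
  refine ⟨hmeas, fun k => ?_, ?_⟩
  · have hmean : ∫ ω, ∑ i, c k i * X i ω ∂μ = 0 := by
      rw [integral_finsetSum _ fun i _ => (h.hasGaussianLaw i).integrable.const_mul _]
      refine Finset.sum_eq_zero fun i _ => ?_
      rw [integral_const_mul, h.integral_comp i measurable_id']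
      simp
    have hvar : Var[fun ω => ∑ i, c k i * X i ω; μ] = 1 := by
      rw [← covariance_self (hmeas k).aemeasurable, hcov]
      simp
    rw [(hlaw.eval k).map_eq_gaussianReal, hmean, hvar]
    simp
  · refine HasGaussianLaw.iIndepFun_of_covariance_eq_zero hlaw fun k l hkl => ?_
    rw [hcov k l, if_neg hkl]

theorem IsStdGaussianFamily.abs_sum_tail [Fintype ι]
    (h : IsStdGaussianFamily μ X) {c : ι → ℝ} {v t : ℝ} (hv : ∑ i, c i ^ 2 ≤ v) (ht : 0 ≤ t) :
    μ.real {ω | t ≤ |∑ i, c i * X i ω|} ≤ 2 * Real.exp (-t ^ 2 / (2 * v)) := by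
  have := h.indep.isProbabilityMeasure
  have hv0 : 0 ≤ v := (Finset.sum_nonneg fun i _ => sq_nonneg _).trans hv
  have hind : iIndepFun (fun i ω => c i * X i ω) μ :=
    h.indep.comp (fun i x => c i * x) fun i => measurable_const_mul _
  have hsg : ∀ i, HasSubgaussianMGF (fun ω => c i * X i ω) (c i ^ 2).toNNReal μ := fun i => by
    refine hasSubgaussianMGF_mono ((h.hasSubgaussianMGF i).const_mul (c i)) (le_of_eq ?_)
    exact (mul_one _).trans (NNReal.eq (Real.coe_toNNReal _ (sq_nonneg _)).symm)
  have hs : HasSubgaussianMGF (fun ω => ∑ i, c i * X i ω) v.toNNReal μ := by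
    refine hasSubgaussianMGF_mono (HasSubgaussianMGF.sum_of_iIndepFun hind (s := Finset.univ)
      fun i _ => hsg i) ?_
    rw [← Real.toNNReal_sum_of_nonneg fun i _ => sq_nonneg _]
    exact Real.toNNReal_le_toNNReal hv
  have hsub : {ω | t ≤ |∑ i, c i * X i ω|} ⊆
      {ω | t ≤ ∑ i, c i * X i ω} ∪ {ω | t ≤ -∑ i, c i * X i ω} := fun ω hω => by
    simpa [le_abs] using hω
  refine (measureReal_mono hsub).trans ((measureReal_union_le _ _).trans ?_)
  have h1 := hs.measure_ge_le ht
  have h2 := hs.neg.measure_ge_le ht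
  simp only [Pi.neg_apply, Real.coe_toNNReal v hv0] at h1 h2
  linarith

theorem IsStdGaussianFamily.abs_tail (h : IsStdGaussianFamily μ X) (i : ι) {t : ℝ} (ht : 0 ≤ t) :
    μ.real {ω | t ≤ |X i ω|} ≤ 2 * Real.exp (-t ^ 2 / 2) := by
  have := h.indep.isProbabilityMeasure
  have h1 : IsStdGaussianFamily μ (fun _ : Unit => X i) :=
    ⟨fun _ => h.measurable i, fun _ => h.law i, iIndepFun.of_subsingleton⟩
  simpa using h1.abs_sum_tail (c := fun _ => 1) (v := 1) (by simp) ht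

theorem IsStdGaussianFamily.measureReal_iUnion_abs_ge_le [Fintype ι]
    (h : IsStdGaussianFamily μ X) {t : ℝ} (ht : 0 ≤ t) :
    μ.real (⋃ i, {ω | t ≤ |X i ω|}) ≤ Fintype.card ι * (2 * Real.exp (-t ^ 2 / 2)) :=
  calc _ ≤ ∑ i, μ.real {ω | t ≤ |X i ω|} := measureReal_iUnion_fintype_le _
    _ ≤ ∑ _i : ι, 2 * Real.exp (-t ^ 2 / 2) := Finset.sum_le_sum fun i _ => h.abs_tail i ht
    _ = _ := by simp

theorem IsStdGaussianFamily.sum_truncation_upper_tail [Fintype ι] (h : IsStdGaussianFamily μ X)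
    {q : ℝ} (hq : 0 ≤ q) {n : ℕ} (hn : Fintype.card ι ≤ n) {T ε : ℝ} (hT : 0 ≤ T) (hε : 0 ≤ ε) :
    μ.real {ω | n * (gaussMoment q + ε) ≤ ∑ i, min (|X i ω| ^ q) (T ^ q)} ≤
      Real.exp (-(2 * n * ε ^ 2) / (T ^ q) ^ 2) := by
  have := h.indep.isProbabilityMeasure
  have hf : Measurable fun z : ℝ => min (|z| ^ q) (T ^ q) := by fun_prop
  set a := ∫ z, min (|z| ^ q) (T ^ q) ∂gaussianReal 0 1
  have ha : a ≤ gaussMoment q := integral_mono_of_nonneg (ae_of_all _ fun z => by positivity)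
    (integrable_abs_rpow_gaussianReal hq) (ae_of_all _ fun z => min_le_left _ _)
  have hsub : ∀ i, HasSubgaussianMGF (fun ω => min (|X i ω| ^ q) (T ^ q) - a)
      ((‖T ^ q - 0‖₊ / 2) ^ 2) μ := fun i => by
    have hb := hasSubgaussianMGF_of_mem_Icc (a := 0) (b := T ^ q)
      (hf.comp (h.measurable i)).aemeasurable
      (ae_of_all μ fun ω => ⟨by simp only [Function.comp_apply]; positivity, min_le_right _ _⟩)
    simp only [Function.comp_apply, h.integral_comp i hf] at hb
    exact hb
  have hind : iIndepFun (fun i ω => min (|X i ω| ^ q) (T ^ q) - a) μ :=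
    h.indep.comp (fun _ x => min (|x| ^ q) (T ^ q) - a) fun _ => hf.sub_const _
  have hsum : HasSubgaussianMGF (fun ω => ∑ i, (min (|X i ω| ^ q) (T ^ q) - a))
      (n * (‖T ^ q - 0‖₊ / 2) ^ 2) μ := by
    refine hasSubgaussianMGF_mono (HasSubgaussianMGF.sum_of_iIndepFun hind (s := Finset.univ)
      fun i _ => hsub i) ?_
    simp only [Finset.sum_const, Finset.card_univ, nsmul_eq_mul]
    gcongr
  refine (measureReal_mono fun ω hω => ?_).trans
    ((hsum.measure_ge_le (ε := n * ε) (by positivity)).trans_eq ?_)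
  · have hcard : Fintype.card ι * a ≤ n * gaussMoment q := by
      have := (gaussMoment_pos hq).le
      gcongr
    simp only [Set.mem_ofPred_eq, Finset.sum_sub_distrib, Finset.sum_const, Finset.card_univ,
      nsmul_eq_mul] at hω ⊢
    linarith
  · push_cast
    rw [sub_zero, Real.norm_of_nonneg (by positivity)]
    congr 1
    rcases n.eq_zero_or_pos with rfl | _
    · simp
    · field_simp

theorem IsStdGaussianFamily.sum_abs_rpow_upper_tail [Fintype ι] (h : IsStdGaussianFamily μ X)
    {q : ℝ} (hq : 0 ≤ q) {n : ℕ} (hn : Fintype.card ι ≤ n) {T ε : ℝ} (hT : 0 ≤ T) (hε : 0 ≤ ε) :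
    μ.real {ω | n * (gaussMoment q + ε) ≤ ∑ i, |X i ω| ^ q} ≤
      n * (2 * Real.exp (-T ^ 2 / 2)) + Real.exp (-(2 * n * ε ^ 2) / (T ^ q) ^ 2) := by
  have := h.indep.isProbabilityMeasure
  have hmax : μ.real (⋃ i, {ω | T ≤ |X i ω|}) ≤ n * (2 * Real.exp (-T ^ 2 / 2)) :=
    (h.measureReal_iUnion_abs_ge_le hT).trans (by gcongr)
  refine (measureReal_mono (s₂ := (⋃ i, {ω | T ≤ |X i ω|}) ∪ {ω | n * (gaussMoment q + ε) ≤
    ∑ i, min (|X i ω| ^ q) (T ^ q)}) fun ω hω => ?_).trans ((measureReal_union_le _ _).trans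
      (add_le_add hmax (h.sum_truncation_upper_tail hq hn hT hε)))
  by_cases hω' : ∃ i, T ≤ |X i ω|
  · exact Or.inl (Set.mem_iUnion.2 hω')
  push Not at hω'
  have hmin : ∀ i, min (|X i ω| ^ q) (T ^ q) = |X i ω| ^ q := fun i =>
    min_eq_left (Real.rpow_le_rpow (abs_nonneg _) (hω' i).le hq)
  exact Or.inr (by simpa only [Set.mem_ofPred_eq, hmin] using hω)

theorem IsStdGaussianFamily.sum_abs_rpow_lower_tail [Fintype ι] (h : IsStdGaussianFamily μ X)
    {q : ℝ} (hq : 0 ≤ q) {n : ℕ} (hn1 : 1 ≤ n) (hn : Fintype.card ι ≤ n) {s : ℝ} (hs : 0 ≤ s) :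
    μ.real {ω | ∑ i, |X i ω| ^ q ≤ Fintype.card ι * gaussMoment q - s} ≤
      Real.exp (-s ^ 2 / (2 * (n * gaussMoment (2 * q)))) := by
  have := h.indep.isProbabilityMeasure
  have hq2 : 0 ≤ 2 * q := by positivity
  have hM : 0 < gaussMoment (2 * q) := gaussMoment_pos hq2
  have : (0 : ℝ) < n := by exact_mod_cast hn1
  have hY : ∀ i, Measurable fun ω => |X i ω| ^ q := fun i => by
    have := h.measurable i
    fun_prop
  have hsq : ∀ i ω, (|X i ω| ^ q) ^ 2 = |X i ω| ^ (2 * q) := fun i ω => by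
    rw [mul_comm, Real.rpow_mul (abs_nonneg _), Real.rpow_two]
  have hmean : ∀ i, ∫ ω, |X i ω| ^ q ∂μ = gaussMoment q := fun i =>
    h.integral_comp i (f := fun z => |z| ^ q) (by fun_prop)
  have hmean2 : ∀ i, ∫ ω, (|X i ω| ^ q) ^ 2 ∂μ = gaussMoment (2 * q) := fun i => by
    simp only [hsq]
    exact h.integral_comp i (f := fun z => |z| ^ (2 * q)) (by fun_prop)
  have hL2 : ∀ i, MemLp (fun ω => |X i ω| ^ q) 2 μ := fun i => by
    rw [memLp_two_iff_integrable_sq (hY i).aestronglyMeasurable]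
    simp only [hsq]
    exact h.integrable_comp i (f := fun z => |z| ^ (2 * q)) (by fun_prop)
      (integrable_abs_rpow_gaussianReal hq2)
  have hV : ∑ i, ∫ ω, (|X i ω| ^ q) ^ 2 ∂μ ≤ n * gaussMoment (2 * q) := by
    simp only [hmean2, Finset.sum_const, Finset.card_univ, nsmul_eq_mul]
    gcongr
  have hind : iIndepFun (fun i ω => |X i ω| ^ q) μ :=
    h.indep.comp (fun _ x => |x| ^ q) fun _ => by fun_prop
  simpa only [hmean, Finset.sum_const, Finset.card_univ, nsmul_eq_mul] using
    measureReal_sum_le_sum_integral_sub_le hind hY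
      (fun i ω => Real.rpow_nonneg (abs_nonneg _) q) hL2 (by positivity) hV hs

end Family

/-! ### Uniform bounds over nets -/

theorem sum_piFinset_pow_hammingNorm {ι α : Type*} [Fintype ι] [DecidableEq ι] [DecidableEq α]
    [Zero α] {s : Finset α} (hs : 0 ∈ s) (r : ℝ) :
    ∑ z ∈ Fintype.piFinset fun _ : ι => s, r ^ hammingNorm z =
      (1 + (s.card - 1) * r) ^ Fintype.card ι := by
  have hcoord : ∑ a ∈ s, (if a ≠ 0 then r else 1) = 1 + (s.card - 1) * r := by
    rw [← Finset.add_sum_erase _ _ hs, Finset.sum_congr rfl fun a ha =>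
      if_pos (Finset.ne_of_mem_erase ha), Finset.sum_const, nsmul_eq_mul,
      Finset.cast_card_erase_of_mem hs]
    simp
  rw [← hcoord, ← Finset.card_univ, ← Finset.prod_const, Finset.prod_univ_sum]
  refine Finset.sum_congr rfl fun z _ => ?_
  rw [Finset.prod_ite]
  simp [hammingNorm]

theorem card_hammingNorm_le_le {n N k : ℕ} (hn : 1 ≤ n) (hN : 1 ≤ N) :
    (((Fintype.piFinset fun _ : Fin n => Finset.Icc (-(N : ℤ)) N).filter
      fun z => hammingNorm z ≤ k).card : ℝ) ≤ Real.exp 1 * (2 * N * n) ^ k := by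
  have hn1 : (1 : ℝ) ≤ n := by exact_mod_cast hn
  have hN1 : (1 : ℝ) ≤ N := by exact_mod_cast hN
  have hb1 : 1 ≤ (2 * N * n : ℝ) := by nlinarith
  set b : ℝ := 2 * N * n with hb
  have hcard : ((Finset.Icc (-(N : ℤ)) N).card : ℝ) - 1 = 2 * N := by
    rw [Int.card_Icc, show ((N : ℤ) + 1 - -N).toNat = 2 * N + 1 by omega]
    push_cast
    ring
  have hexp : (1 + (n : ℝ)⁻¹) ^ n ≤ Real.exp 1 := by
    calc (1 + (n : ℝ)⁻¹) ^ n ≤ Real.exp (n : ℝ)⁻¹ ^ n := by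
          gcongr
          rw [add_comm]
          exact Real.add_one_le_exp _
      _ = Real.exp 1 := by rw [← Real.exp_nat_mul, mul_inv_cancel₀ (by positivity)]
  rw [Finset.cast_card]
  calc _ ≤ ∑ z ∈ (Fintype.piFinset fun _ : Fin n => Finset.Icc (-(N : ℤ)) N).filter
        (fun z => hammingNorm z ≤ k), b ^ k * b⁻¹ ^ hammingNorm z := by
        refine Finset.sum_le_sum fun z hz => ?_
        rw [inv_pow, ← div_eq_mul_inv, one_le_div (by positivity)]
        exact pow_le_pow_right₀ hb1 (Finset.mem_filter.1 hz).2
    _ ≤ ∑ z ∈ Fintype.piFinset fun _ : Fin n => Finset.Icc (-(N : ℤ)) N,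
        b ^ k * b⁻¹ ^ hammingNorm z :=
        Finset.sum_le_sum_of_subset_of_nonneg (Finset.filter_subset _ _)
          fun z _ _ => by positivity
    _ = b ^ k * (1 + (n : ℝ)⁻¹) ^ n := by
        rw [← Finset.mul_sum, sum_piFinset_pow_hammingNorm (by simp), hcard, Fintype.card_fin, hb]
        congr 3
        field_simp
    _ ≤ Real.exp 1 * b ^ k := by
        rw [mul_comm]
        gcongr

theorem sum_prod_mul_mul {ι κ : Type*} [Fintype ι] [Fintype κ] (x x' : ι → ℝ) (y y' : κ → ℝ) :
    ∑ ab : ι × κ, x ab.1 * y ab.2 * (x' ab.1 * y' ab.2) = (x ⬝ᵥ x') * (y ⬝ᵥ y') := by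
  simp only [dotProduct, Finset.sum_mul_sum, Fintype.sum_prod_type, mul_mul_mul_comm]

theorem sum_prod_mul_apply {ι κ : Type*} [Fintype ι] [Fintype κ] (A : Matrix ι κ ℝ) (x : ι → ℝ)
    (y : κ → ℝ) : ∑ ab : ι × κ, x ab.1 * y ab.2 * A ab.1 ab.2 = x ⬝ᵥ A *ᵥ y := by
  simp only [dotProduct, Matrix.mulVec, Finset.mul_sum, Fintype.sum_prod_type]
  exact Finset.sum_congr rfl fun i _ => Finset.sum_congr rfl fun j _ => by ring

section Nets

variable {Ω : Type*} [MeasurableSpace Ω] {μ : Measure Ω} {n : ℕ}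
  {G : Ω → Matrix (Fin n) (Fin n) ℝ}

theorem IsStdGaussianMatrix.isStdGaussianFamily (h : IsStdGaussianMatrix μ G) :
    IsStdGaussianFamily μ (fun (ij : Fin n × Fin n) ω => G ω ij.1 ij.2) :=
  ⟨fun ij => h.measurable ij.1 ij.2, fun ij => h.law ij.1 ij.2, h.indep⟩

theorem IsStdGaussianMatrix.abs_dotProduct_mulVec_tail (h : IsStdGaussianMatrix μ G)
    (x y : Fin n → ℝ) {v t : ℝ} (hv : (x ⬝ᵥ x) * (y ⬝ᵥ y) ≤ v) (ht : 0 ≤ t) :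
    μ.real {ω | t ≤ |x ⬝ᵥ G ω *ᵥ y|} ≤ 2 * Real.exp (-t ^ 2 / (2 * v)) := by
  simp only [← sum_prod_mul_apply]
  refine h.isStdGaussianFamily.abs_sum_tail (le_of_eq_of_le ?_ hv) ht
  simp only [sq, sum_prod_mul_mul]

theorem symMatrix_mulVec_apply (A : Matrix (Fin n) (Fin n) ℝ) (u : Fin n → ℝ) (j : Fin n) :
    (symMatrix A *ᵥ u) j = ∑ ab : Fin n × Fin n,
      (√2)⁻¹ * (basisVec j ab.1 * u ab.2 + u ab.1 * basisVec j ab.2) * A ab.1 ab.2 := by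
  simp only [mul_assoc (√2)⁻¹, add_mul, ← Finset.mul_sum, Finset.sum_add_distrib,
    sum_prod_mul_apply]
  rw [Matrix.dotProduct_mulVec u, ← Matrix.mulVec_transpose]
  simp [basisVec, symMatrix, Matrix.smul_mulVec, Matrix.add_mulVec, mul_add]

theorem IsStdGaussianMatrix.isStdGaussianFamily_symMatrix_mulVec (h : IsStdGaussianMatrix μ G)
    {u : Fin n → ℝ} (hu : u ⬝ᵥ u = 1) :
    IsStdGaussianFamily μ fun (j : {j // u j = 0}) ω => (symMatrix (G ω) *ᵥ u) j := by
  have hhalf : (√2)⁻¹ * (√2)⁻¹ = (1 / 2 : ℝ) := by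
    rw [← mul_inv, Real.mul_self_sqrt zero_le_two, one_div]
  simp only [symMatrix_mulVec_apply]
  refine h.isStdGaussianFamily.linearForms (fun (j : {j // u j = 0}) ab =>
    (√2)⁻¹ * (basisVec j.1 ab.1 * u ab.2 + u ab.1 * basisVec j.1 ab.2)) fun k l => ?_
  simp only [mul_mul_mul_comm (√2)⁻¹ _ (√2)⁻¹, hhalf, ← Finset.mul_sum]
  simp only [add_mul, mul_add, Finset.sum_add_distrib, sum_prod_mul_mul, hu]
  rcases eq_or_ne k l with rfl | hkl
  · norm_num [basisVec, k.2]
  · simp [basisVec, k.2, hkl, Subtype.coe_inj]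

theorem IsStdGaussianMatrix.normP_symMatrix_mulVec_tail_of_unit (h : IsStdGaussianMatrix μ G)
    {q : ℝ} (hq : 0 < q) {T ε : ℝ} (hT : 0 ≤ T) (hε : 0 ≤ ε) {u : Fin n → ℝ}
    (hu : u ⬝ᵥ u = 1) :
    μ.real {ω | (n * (gaussMoment q + ε)) ^ (1 / q) <
      normP q ({j | u j = 0}.indicator (symMatrix (G ω) *ᵥ u))} ≤
      n * (2 * Real.exp (-T ^ 2 / 2)) + Real.exp (-(2 * n * ε ^ 2) / (T ^ q) ^ 2) := by
  classical
  have := h.indep.isProbabilityMeasure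
  have hm := (gaussMoment_pos hq.le).le
  have hcard : Fintype.card {j : Fin n // u j = 0} ≤ n :=
    (Fintype.card_subtype_le _).trans (Fintype.card_fin n).le
  refine (measureReal_mono fun ω hω => ?_).trans
    ((h.isStdGaussianFamily_symMatrix_mulVec hu).sum_abs_rpow_upper_tail hq.le hcard hT hε)
  have hlt := (Real.rpow_lt_rpow_iff (by positivity) (normP_nonneg _ _) hq).2 hω
  rw [normP_rpow hq.ne', ← Real.rpow_mul (by positivity), one_div_mul_cancel hq.ne',
    Real.rpow_one] at hlt
  refine hlt.le.trans_eq ?_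
  simp only [Set.indicator_apply, Set.mem_ofPred_eq, apply_ite abs, apply_ite (· ^ q), abs_zero,
    Real.zero_rpow hq.ne', ← Finset.sum_filter]
  exact Finset.sum_subtype _ (by simp) _

theorem IsStdGaussianMatrix.normP_symMatrix_mulVec_tail (h : IsStdGaussianMatrix μ G)
    {q : ℝ} (hq : 0 < q) {T ε : ℝ} (hT : 0 ≤ T) (hε : 0 ≤ ε) (u : Fin n → ℝ) :
    μ.real {ω | (n * (gaussMoment q + ε)) ^ (1 / q) * normP 2 u <
      normP q ({j | u j = 0}.indicator (symMatrix (G ω) *ᵥ u))} ≤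
      n * (2 * Real.exp (-T ^ 2 / 2)) + Real.exp (-(2 * n * ε ^ 2) / (T ^ q) ^ 2) := by
  have := h.indep.isProbabilityMeasure
  rcases (normP_nonneg 2 u).eq_or_lt with h0 | h0
  · have hu : u = 0 := by
      funext i
      simpa [← h0] using abs_apply_le_normP two_pos u i
    refine le_of_eq_of_le ?_ (by positivity : (0 : ℝ) ≤ _)
    simp [hu, normP, Real.zero_rpow hq.ne', Real.zero_rpow (inv_ne_zero hq.ne')]
  set v := (normP 2 u)⁻¹ • u
  have hv : v ⬝ᵥ v = 1 := by
    have hsq : u ⬝ᵥ u = normP 2 u ^ 2 := by rw [normP_two_sq, dotProduct]; simp only [sq]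
    simp only [v, smul_dotProduct, dotProduct_smul, smul_eq_mul, hsq]
    field_simp
  have hind (ω : Ω) : {j | v j = 0}.indicator (symMatrix (G ω) *ᵥ v) =
      (normP 2 u)⁻¹ • {j | u j = 0}.indicator (symMatrix (G ω) *ᵥ u) := by
    have hzero : {j | v j = 0} = {j | u j = 0} := by simp [v, h0.ne']
    rw [hzero, Matrix.mulVec_smul]
    exact Set.indicator_const_smul _ (normP 2 u)⁻¹ (symMatrix (G ω) *ᵥ u)
  refine (measureReal_mono fun ω hω => ?_).trans
    (h.normP_symMatrix_mulVec_tail_of_unit hq hT hε hv)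
  simp only [Set.mem_ofPred_eq, hind, normP_smul hq, abs_inv, abs_of_pos h0] at hω ⊢
  rwa [← div_eq_inv_mul, lt_div_iff₀ h0]

theorem IsStdGaussianMatrix.measureReal_not_sparseImageBound_le (h : IsStdGaussianMatrix μ G)
    {q : ℝ} (hq : 0 < q) {T ε : ℝ} (hT : 0 ≤ T) (hε : 0 ≤ ε) (hn : 1 ≤ n) {N k : ℕ} (hN : 1 ≤ N) :
    μ.real {ω | ¬SparseImageBound q ((n * (gaussMoment q + ε)) ^ (1 / q)) N k
      (symMatrix (G ω))} ≤ Real.exp 1 * (2 * N * n) ^ k *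
        (n * (2 * Real.exp (-T ^ 2 / 2)) + Real.exp (-(2 * n * ε ^ 2) / (T ^ q) ^ 2)) := by
  have := h.indep.isProbabilityMeasure
  set F := (Fintype.piFinset fun _ : Fin n => Finset.Icc (-(N : ℤ)) N).filter
    fun z => hammingNorm z ≤ k
  have hcover : {ω | ¬SparseImageBound q ((n * (gaussMoment q + ε)) ^ (1 / q)) N k
      (symMatrix (G ω))} ⊆ ⋃ z ∈ F, {ω | (n * (gaussMoment q + ε)) ^ (1 / q) *
        normP 2 (fun i => (z i : ℝ)) < normP q
          ({j | (z j : ℝ) = 0}.indicator (symMatrix (G ω) *ᵥ fun i => (z i : ℝ)))} := by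
    intro ω hω
    simp only [Set.mem_ofPred_eq, SparseImageBound, not_forall, not_le] at hω
    obtain ⟨z, hz, hzk, hlt⟩ := hω
    simp only [Set.mem_iUnion, Set.mem_ofPred_eq, Int.cast_eq_zero]
    exact ⟨z, Finset.mem_filter.2
      ⟨Fintype.mem_piFinset.2 fun i => Finset.mem_Icc.2 (abs_le.1 (hz i)), hzk⟩, hlt⟩
  refine (measureReal_mono hcover (measure_ne_top _ _)).trans
    ((measureReal_biUnion_finset_le _ _).trans ((Finset.sum_le_sum fun z _ =>
      h.normP_symMatrix_mulVec_tail hq hT hε _).trans ?_))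
  rw [Finset.sum_const, nsmul_eq_mul]
  gcongr
  exact card_hammingNorm_le_le hn hN

theorem dotProduct_self_coe_signType (s : Fin n → SignType) :
    (fun i => (s i : ℝ)) ⬝ᵥ (fun i => (s i : ℝ)) = hammingNorm s := by
  have hcoord (a : SignType) : (a : ℝ) * a = if a ≠ 0 then 1 else 0 := by cases a <;> simp
  simp only [dotProduct, hcoord, hammingNorm, Finset.natCast_card_filter]

theorem IsStdGaussianMatrix.abs_dotProduct_mulVec_signType_tail (h : IsStdGaussianMatrix μ G)
    {K : ℝ} (hK : 0 ≤ K) {s t : Fin n → SignType} (hs : s ≠ 0) (ht : t ≠ 0) :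
    μ.real {ω | K * (√(hammingNorm s) * hammingNorm t + hammingNorm s * √(hammingNorm t)) <
      |(fun i => (s i : ℝ)) ⬝ᵥ G ω *ᵥ fun i => (t i : ℝ)|} ≤
      2 * (Real.exp (-K ^ 2 / 2) ^ hammingNorm s * Real.exp (-K ^ 2 / 2) ^ hammingNorm t) := by
  have := h.indep.isProbabilityMeasure
  have htail := h.abs_dotProduct_mulVec_tail (fun i => (s i : ℝ)) (fun i => (t i : ℝ))
    (v := hammingNorm s * hammingNorm t)
    (t := K * (√(hammingNorm s) * hammingNorm t + hammingNorm s * √(hammingNorm t)))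
    (by simp only [dotProduct_self_coe_signType, le_refl]) (by positivity)
  rw [← Real.exp_nat_mul, ← Real.exp_nat_mul, ← Real.exp_add]
  have ha0 : (0 : ℝ) < hammingNorm s := by exact_mod_cast hammingNorm_pos_iff.2 hs
  have hb0 : (0 : ℝ) < hammingNorm t := by exact_mod_cast hammingNorm_pos_iff.2 ht
  generalize (hammingNorm s : ℝ) = a at *
  generalize (hammingNorm t : ℝ) = b at *
  refine (measureReal_mono (fun ω hω => ?_) (measure_ne_top _ _)).trans (htail.trans ?_)
  · exact (Set.mem_ofPred_eq ▸ hω : _ < _).le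
  have hsq : a * b * (a + b) ≤ (√a * b + a * √b) ^ 2 :=
    calc a * b * (a + b) = √a ^ 2 * b ^ 2 + a ^ 2 * √b ^ 2 := by
          rw [Real.sq_sqrt ha0.le, Real.sq_sqrt hb0.le]
          ring
      _ ≤ √a ^ 2 * b ^ 2 + a ^ 2 * √b ^ 2 + 2 * (√a * b) * (a * √b) :=
          le_add_of_nonneg_right (by positivity)
      _ = _ := by ring
  gcongr
  rw [div_le_iff₀ (by positivity), mul_pow]
  nlinarith [mul_le_mul_of_nonneg_left hsq (sq_nonneg K)]

theorem IsStdGaussianMatrix.measureReal_not_signFormBound_le (h : IsStdGaussianMatrix μ G) {K : ℝ}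
    (hK : 0 ≤ K) :
    μ.real {ω | ¬SignFormBound K (G ω)} ≤
      2 * ((1 + 2 * Real.exp (-K ^ 2 / 2)) ^ n - 1) ^ 2 := by
  have := h.indep.isProbabilityMeasure
  set r := Real.exp (-K ^ 2 / 2)
  set F : Finset (Fin n → SignType) := Finset.univ.erase 0
  have hsum : ∑ s ∈ F, r ^ hammingNorm s = (1 + 2 * r) ^ n - 1 := by
    have hall := sum_piFinset_pow_hammingNorm (ι := Fin n) (Finset.mem_univ (0 : SignType)) r
    rw [Fintype.piFinset_univ, ← Finset.add_sum_erase _ _ (Finset.mem_univ 0)] at hall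
    have hcard : ((Finset.univ : Finset SignType).card : ℝ) - 1 = (2 : ℝ) := by
      rw [Finset.card_univ, show Fintype.card SignType = 3 from rfl]
      norm_num
    rw [hammingNorm_zero, pow_zero, Fintype.card_fin, hcard] at hall
    exact eq_sub_of_add_eq' hall
  have hcover : {ω | ¬SignFormBound K (G ω)} ⊆ ⋃ st ∈ F ×ˢ F,
      {ω | K * (√(hammingNorm st.1) * hammingNorm st.2 + hammingNorm st.1 * √(hammingNorm st.2)) <
        |(fun i => (st.1 i : ℝ)) ⬝ᵥ G ω *ᵥ fun i => (st.2 i : ℝ)|} := by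
    intro ω hω
    simp only [Set.mem_ofPred_eq, SignFormBound, not_forall, not_le] at hω
    obtain ⟨s, t, hlt⟩ := hω
    have hs : s ≠ 0 := by
      rintro rfl
      simp [dotProduct] at hlt
    have ht : t ≠ 0 := by
      rintro rfl
      simp [dotProduct, Matrix.mulVec] at hlt
    simp only [Set.mem_iUnion]
    exact ⟨(s, t), by simp [F, hs, ht], hlt⟩
  calc _ ≤ ∑ st ∈ F ×ˢ F, 2 * (r ^ hammingNorm st.1 * r ^ hammingNorm st.2) := by
        refine (measureReal_mono hcover (measure_ne_top _ _)).trans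
          ((measureReal_biUnion_finset_le _ _).trans (Finset.sum_le_sum fun st hst => ?_))
        obtain ⟨hs, ht⟩ := Finset.mem_product.1 hst
        exact h.abs_dotProduct_mulVec_signType_tail hK (Finset.ne_of_mem_erase hs)
          (Finset.ne_of_mem_erase ht)
    _ = 2 * ((∑ s ∈ F, r ^ hammingNorm s) * ∑ t ∈ F, r ^ hammingNorm t) := by
        rw [← Finset.mul_sum, Finset.sum_product, Finset.sum_mul_sum]
    _ = _ := by rw [hsum, sq]

end Nets

/-! ### Almost sure upper bound -/

section Asymptotics

theorem ae_eventually_notMem_of_measureReal_le {Ω : Type*} [MeasurableSpace Ω] {μ : Measure Ω}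
    [IsFiniteMeasure μ] {E : ℕ → Set Ω} {C s : ℝ} (hs : s < -1)
    (h : ∀ᶠ n : ℕ in atTop, μ.real (E n) ≤ C * (n : ℝ) ^ s) :
    ∀ᵐ ω ∂μ, ∀ᶠ n in atTop, ω ∉ E n := by
  refine ae_eventually_notMem ?_
  have hsum : Summable fun n => μ.real (E n) := by
    refine ((Real.summable_nat_rpow.2 hs).mul_left C).of_norm_bounded_eventually_nat ?_
    filter_upwards [h] with n hn
    rwa [Real.norm_of_nonneg measureReal_nonneg]
  have hreal (n : ℕ) : μ (E n) = ENNReal.ofReal (μ.real (E n)) :=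
    (ofReal_measureReal (measure_ne_top _ _)).symm
  simp only [hreal]
  exact hsum.tsum_ofReal_ne_top

theorem eventually_log_le_mul_rpow {a c : ℝ} (ha : 0 < a) (hc : 0 < c) :
    ∀ᶠ n : ℕ in atTop, Real.log n ≤ c * (n : ℝ) ^ a := by
  filter_upwards [tendsto_natCast_atTop_atTop.eventually
    ((isLittleO_log_rpow_atTop ha).bound hc)] with n hn
  rw [Real.norm_of_nonneg (by positivity : 0 ≤ (n : ℝ) ^ a)] at hn
  exact (Real.le_norm_self _).trans hn

theorem tendsto_natCast_rpow_neg {a : ℝ} (ha : 0 < a) :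
    Tendsto (fun n : ℕ => (n : ℝ) ^ (-a)) atTop (𝓝 0) :=
  (tendsto_rpow_neg_atTop ha).comp tendsto_natCast_atTop_atTop

theorem tendsto_sqrt_log_mul_rpow_neg {a : ℝ} (ha : 0 < a) (c : ℝ) :
    Tendsto (fun n : ℕ => √(c * Real.log n) * (n : ℝ) ^ (-a)) atTop (𝓝 0) := by
  have hlog : Tendsto (fun x : ℝ => c * (Real.log x / x ^ (2 * a))) atTop (𝓝 0) := by
    simpa using
      (isLittleO_log_rpow_atTop (by positivity : 0 < 2 * a)).tendsto_div_nhds_zero.const_mul c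
  have hsqrt := (Real.continuous_sqrt.tendsto 0).comp (hlog.comp tendsto_natCast_atTop_atTop)
  rw [Real.sqrt_zero] at hsqrt
  refine hsqrt.congr fun n => ?_
  have hn : √((n : ℝ) ^ (2 * a)) = (n : ℝ) ^ a := by
    rw [Real.sqrt_eq_rpow, ← Real.rpow_mul n.cast_nonneg]
    ring_nf
  simp only [Function.comp_apply]
  rw [← mul_div_assoc, Real.sqrt_div' _ (by positivity), hn, Real.rpow_neg n.cast_nonneg,
    div_eq_mul_inv]

theorem natCeil_rpow_le {a x : ℝ} (ha : 0 ≤ a) (hx : 1 ≤ x) : (⌈x ^ a⌉₊ : ℝ) ≤ 2 * x ^ a := by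
  linarith [(Nat.ceil_lt_add_one (by positivity : 0 ≤ x ^ a)).le, Real.one_le_rpow hx ha]

theorem two_mul_pow_sub_one_sq_le {n : ℕ} (hn : 2 ≤ n) :
    2 * ((1 + 2 * Real.exp (-√(6 * Real.log n) ^ 2 / 2)) ^ n - 1) ^ 2 ≤
      32 * (n : ℝ) ^ (-2 : ℝ) := by
  have hn2 : (2 : ℝ) ≤ n := by exact_mod_cast hn
  have hn0 : (0 : ℝ) < n := by linarith
  have : 0 ≤ Real.log n := Real.log_nonneg (by linarith)
  have hexp : Real.exp (-√(6 * Real.log n) ^ 2 / 2) = ((n : ℝ) ^ 3)⁻¹ := by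
    rw [Real.sq_sqrt (by positivity), show -(6 * Real.log n) / 2 = -((3 : ℕ) * Real.log n) by
      push_cast; ring, Real.exp_neg, Real.exp_nat_mul, Real.exp_log hn0]
  rw [hexp, show (n : ℝ) ^ (-2 : ℝ) = ((n : ℝ) ^ 2)⁻¹ by rw [Real.rpow_neg hn0.le]; norm_cast]
  set x : ℝ := ((n : ℝ) ^ 2)⁻¹ with hx
  have hx0 : 0 ≤ x := by positivity
  have hx1 : 2 * x ≤ 1 := by
    rw [hx, ← div_eq_mul_inv, div_le_one (by positivity)]
    nlinarith
  have hone : 1 ≤ (1 + 2 * ((n : ℝ) ^ 3)⁻¹) ^ n :=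
    one_le_pow₀ (le_add_of_nonneg_right (by positivity))
  have hpow : (1 + 2 * ((n : ℝ) ^ 3)⁻¹) ^ n ≤ Real.exp (2 * x) := by
    calc (1 + 2 * ((n : ℝ) ^ 3)⁻¹) ^ n ≤ Real.exp (2 * ((n : ℝ) ^ 3)⁻¹) ^ n := by
          gcongr
          rw [add_comm]
          exact Real.add_one_le_exp _
      _ = Real.exp (2 * x) := by
          rw [← Real.exp_nat_mul, hx]
          congr 1
          field_simp
  have hsub : Real.exp (2 * x) - 1 ≤ 4 * x := by
    have := (le_abs_self _).trans
      (Real.abs_exp_sub_one_le (x := 2 * x) (by rwa [abs_of_nonneg (by positivity)]))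
    rw [abs_of_nonneg (by positivity)] at this
    linarith
  calc 2 * ((1 + 2 * ((n : ℝ) ^ 3)⁻¹) ^ n - 1) ^ 2 ≤ 2 * (4 * x) ^ 2 := by
        gcongr
        linarith
    _ ≤ 32 * x := by nlinarith

theorem two_mul_mul_pow_natCeil_le_exp {x y : ℝ} (hx : 3 ≤ x) (hy : 1 ≤ y) :
    (2 * x * x) ^ ⌈y⌉₊ ≤ Real.exp (6 * y * Real.log x) := by
  have hx0 : 0 < x := by linarith
  have hlog : 0 ≤ Real.log x := Real.log_nonneg (by linarith)
  have hceil : (⌈y⌉₊ : ℝ) ≤ 2 * y := by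
    linarith [(Nat.ceil_lt_add_one (by positivity : 0 ≤ y)).le]
  calc (2 * x * x) ^ ⌈y⌉₊ ≤ (x ^ 3) ^ ⌈y⌉₊ := by
        gcongr
        nlinarith [mul_pos hx0 hx0]
    _ = Real.exp (⌈y⌉₊ * (3 * Real.log x)) := by
        rw [Real.exp_nat_mul, show 3 * Real.log x = (3 : ℕ) * Real.log x by norm_num,
          Real.exp_nat_mul, Real.exp_log hx0]
    _ ≤ _ := by
        rw [Real.exp_le_exp]
        nlinarith [mul_le_mul_of_nonneg_right hceil hlog]

theorem half_sq_rpow_le {q x : ℝ} (hq : 2 < q) (hx : 1 ≤ x) :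
    (x ^ (1 / (8 * q))) ^ 2 / 2 ≤
      2 * x * (x ^ (-(1 / 8 : ℝ))) ^ 2 / ((x ^ (1 / (8 * q))) ^ q) ^ 2 := by
  have hx0 : 0 < x := by linarith
  have hq0 : 0 < q := by linarith
  have hright : 2 * x * (x ^ (-(1 / 8 : ℝ))) ^ 2 / ((x ^ (1 / (8 * q))) ^ q) ^ 2 =
      2 * x ^ (1 / 2 : ℝ) := by
    rw [← Real.rpow_mul hx0.le, one_div_mul_eq_div, div_mul_cancel_right₀ hq0.ne', mul_assoc,
      mul_div_assoc, ← Real.rpow_mul_natCast hx0.le, ← Real.rpow_mul_natCast hx0.le]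
    nth_rewrite 1 [← Real.rpow_one x]
    rw [← Real.rpow_add hx0, ← Real.rpow_sub hx0]
    norm_num
  have hleft : (x ^ (1 / (8 * q))) ^ 2 ≤ x ^ (1 / 2 : ℝ) := by
    rw [← Real.rpow_mul_natCast hx0.le]
    refine Real.rpow_le_rpow_of_exponent_le hx ?_
    rw [Nat.cast_ofNat, div_mul_eq_mul_div, div_le_div_iff₀ (by positivity) (by norm_num)]
    linarith
  rw [hright]
  linarith [sq_nonneg (x ^ (1 / (8 * q)))]

theorem eventually_net_union_bound_le {q : ℝ} (hq : 2 < q) :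
    ∀ᶠ n : ℕ in atTop,
      Real.exp 1 * (2 * n * n) ^ ⌈(n : ℝ) ^ (1 / (8 * q))⌉₊ *
        (n * (2 * Real.exp (-((n : ℝ) ^ (1 / (8 * q))) ^ 2 / 2)) +
          Real.exp (-(2 * n * ((n : ℝ) ^ (-(1 / 8 : ℝ))) ^ 2) /
            (((n : ℝ) ^ (1 / (8 * q))) ^ q) ^ 2)) ≤ (n : ℝ) ^ (-2 : ℝ) := by
  have ha : 0 < 1 / (8 * q) := by positivity
  filter_upwards [eventually_log_le_mul_rpow ha (by norm_num : (0 : ℝ) < 1 / 22),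
    eventually_ge_atTop 3] with n hlog hn
  have hn3 : (3 : ℝ) ≤ n := by exact_mod_cast hn
  have hn0 : (0 : ℝ) < n := by linarith
  have hsecond := half_sq_rpow_le hq (by linarith : (1 : ℝ) ≤ n)
  have hy := Real.one_le_rpow (by linarith : (1 : ℝ) ≤ n) ha.le
  set y := (n : ℝ) ^ (1 / (8 * q))
  set l := Real.log n with hl
  have hl1 : 1 ≤ l := by
    rw [hl, Real.le_log_iff_exp_le hn0]
    exact Real.exp_one_lt_d9.le.trans (by linarith)
  have hexp : Real.exp l = n := Real.exp_log hn0
  have hlin : 2 * (n : ℝ) + 1 ≤ Real.exp (2 * l) := by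
    rw [two_mul l, Real.exp_add, hexp]
    nlinarith
  calc _ ≤ Real.exp l * Real.exp (6 * y * l) *
        (n * (2 * Real.exp (-y ^ 2 / 2)) + Real.exp (-y ^ 2 / 2)) := by
        gcongr ?_ * ?_ * (_ + ?_)
        · exact Real.exp_le_exp.2 hl1
        · exact two_mul_mul_pow_natCeil_le_exp hn3 hy
        · rwa [Real.exp_le_exp, neg_div, neg_div, neg_le_neg_iff]
    _ = Real.exp l * Real.exp (6 * y * l) * ((2 * n + 1) * Real.exp (-y ^ 2 / 2)) := by ring
    _ ≤ Real.exp l * Real.exp (6 * y * l) * (Real.exp (2 * l) * Real.exp (-y ^ 2 / 2)) := by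
        gcongr
    _ = Real.exp (l + 6 * y * l + (2 * l + -y ^ 2 / 2)) := by simp only [Real.exp_add]
    _ ≤ Real.exp (l * (-2)) := by
        rw [Real.exp_le_exp]
        nlinarith
    _ = _ := by rw [hl, Real.rpow_def_of_pos hn0]

end Asymptotics

section Max

variable {p q : ℝ} {n k : ℕ}

theorem two_lt_of_holderConjugate (hpq : p.HolderConjugate q) (hp2 : p < 2) : 2 < q := by
  have h : 1 / 2 < p⁻¹ := by rwa [one_div, inv_lt_inv₀ two_pos hpq.pos]
  rw [← inv_lt_inv₀ hpq.symm.pos two_pos]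
  linarith [hpq.inv_add_inv_eq_one]

theorem natCeil_rpow_rpow_le {a : ℝ} (hq : 2 ≤ q) (ha : 0 ≤ a) (hn : 1 ≤ n) :
    (⌈(n : ℝ) ^ a⌉₊ : ℝ) ^ (2 / q) ≤ 2 * (n : ℝ) ^ (-((1 - 2 * a) / q)) * (n : ℝ) ^ (1 / q) := by
  have hn1 : (1 : ℝ) ≤ n := by exact_mod_cast hn
  have hn0 : (0 : ℝ) < n := by linarith
  have hq1 : 2 / q ≤ 1 := (div_le_one (by linarith)).2 hq
  calc (⌈(n : ℝ) ^ a⌉₊ : ℝ) ^ (2 / q) ≤ (2 * (n : ℝ) ^ a) ^ (2 / q) := by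
        gcongr
        exact natCeil_rpow_le ha hn1
    _ = 2 ^ (2 / q) * (n : ℝ) ^ (-((1 - 2 * a) / q) + 1 / q) := by
        rw [Real.mul_rpow zero_le_two (by positivity), ← Real.rpow_mul hn0.le]
        ring_nf
    _ ≤ 2 ^ (1 : ℝ) * (n : ℝ) ^ (-((1 - 2 * a) / q) + 1 / q) := by
        gcongr
        norm_num
    _ = _ := by rw [Real.rpow_one, Real.rpow_add hn0, mul_assoc]

theorem natCeil_rpow_div_le {a : ℝ} (ha : 0 ≤ a) (hn : 1 ≤ n) :
    (⌈(n : ℝ) ^ a⌉₊ : ℝ) / n ≤ 2 * (n : ℝ) ^ (-(1 - a)) := by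
  have hn1 : (1 : ℝ) ≤ n := by exact_mod_cast hn
  have hn0 : (0 : ℝ) < n := by linarith
  rw [div_le_iff₀ hn0, mul_assoc, ← Real.rpow_add_one hn0.ne', neg_sub, sub_add_cancel]
  exact natCeil_rpow_le ha hn1

theorem SignFormBound.maxForm_le {a m K : ℝ} (hpq : p.HolderConjugate q) (hp2 : p < 2)
    (hn : 1 ≤ n) (ha : 0 ≤ a) (hm : 0 ≤ m) {A : Matrix (Fin n) (Fin n) ℝ}
    (hA : SignFormBound K A)
    (hB : SparseImageBound q ((n * m) ^ (1 / q)) n ⌈(n : ℝ) ^ a⌉₊ (symMatrix A)) :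
    maxForm p A ≤ (n : ℝ) ^ (1 / q) * (√2 * 2 ^ (-(2 / p)) * m ^ (1 / q) +
      (4 * (K * (n : ℝ) ^ (-((1 - 2 * a) / q))) +
        2 / (1 - p / 2) * (K * (n : ℝ) ^ (-(a / p * (1 - p / 2)))) +
        8 * (K * (n : ℝ) ^ (-(1 - a))))) := by
  have hp := hpq.pos
  have hq := (two_lt_of_holderConjugate hpq hp2).le
  have hn0 : (0 : ℝ) < n := by exact_mod_cast hn
  have hK := hA.nonneg hn
  obtain ⟨x, hx, hxm⟩ := (isGreatest_maxForm hpq.lt.le hn A).1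
  rw [← hxm]
  have hδ : ((n : ℝ) ^ (-(a / p))) ^ (-p) = (n : ℝ) ^ a := by
    rw [← Real.rpow_mul hn0.le, neg_mul_neg, div_mul_cancel₀ _ hp.ne']
  calc quadForm A x ≤ _ :=
        hA.quadForm_le hpq hp2 hn hn (by positivity) hB (by positivity)
          (hδ.trans_le (Nat.le_ceil _)) hx
    _ ≤ √2 * 2 ^ (-(2 / p)) * ((n : ℝ) ^ (1 / q) * m ^ (1 / q)) +
        2 * K * (2 * (n : ℝ) ^ (-((1 - 2 * a) / q)) * (n : ℝ) ^ (1 / q)) +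
        2 * K * ((n : ℝ) ^ (-(a / p * (1 - p / 2))) / (1 - p / 2)) * (n : ℝ) ^ (1 / q) +
        4 * K * (2 * (n : ℝ) ^ (-(1 - a))) * (n : ℝ) ^ (1 / q) := by
        rw [Real.mul_rpow hn0.le hm, ← Real.rpow_mul hn0.le, neg_mul]
        gcongr
        · exact natCeil_rpow_rpow_le hq ha hn
        · exact natCeil_rpow_div_le ha hn
    _ = _ := by ring

variable {Ω : Type*} [MeasurableSpace Ω] {μ : Measure Ω} [IsProbabilityMeasure μ]
  {G : (n : ℕ) → Ω → Matrix (Fin n) (Fin n) ℝ}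

theorem ae_eventually_signFormBound_and_sparseImageBound
    (hG : ∀ n, IsStdGaussianMatrix μ (G n)) (hq : 2 < q) :
    ∀ᵐ ω ∂μ, ∀ᶠ n : ℕ in atTop, SignFormBound √(6 * Real.log n) (G n ω) ∧
      SparseImageBound q ((n * (gaussMoment q + (n : ℝ) ^ (-(1 / 8 : ℝ)))) ^ (1 / q)) n
        ⌈(n : ℝ) ^ (1 / (8 * q))⌉₊ (symMatrix (G n ω)) := by
  have hsign : ∀ᶠ n : ℕ in atTop, μ.real {ω | ¬SignFormBound √(6 * Real.log n) (G n ω)} ≤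
      32 * (n : ℝ) ^ (-2 : ℝ) := by
    filter_upwards [eventually_ge_atTop 2] with n hn
    exact ((hG n).measureReal_not_signFormBound_le (Real.sqrt_nonneg _)).trans
      (two_mul_pow_sub_one_sq_le hn)
  have hsparse : ∀ᶠ n : ℕ in atTop, μ.real {ω | ¬SparseImageBound q
      ((n * (gaussMoment q + (n : ℝ) ^ (-(1 / 8 : ℝ)))) ^ (1 / q)) n
        ⌈(n : ℝ) ^ (1 / (8 * q))⌉₊ (symMatrix (G n ω))} ≤ 1 * (n : ℝ) ^ (-2 : ℝ) := by
    filter_upwards [eventually_net_union_bound_le hq, eventually_ge_atTop 1] with n hnet hn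
    rw [one_mul]
    exact ((hG n).measureReal_not_sparseImageBound_le (by linarith) (by positivity)
      (by positivity) hn hn).trans hnet
  filter_upwards [ae_eventually_notMem_of_measureReal_le (by norm_num) hsign,
    ae_eventually_notMem_of_measureReal_le (by norm_num) hsparse] with ω h₁ h₂
  filter_upwards [h₁, h₂] with n hn₁ hn₂
  exact ⟨not_not.1 hn₁, not_not.1 hn₂⟩

theorem exists_tendsto_ae_eventually_maxForm_le (hG : ∀ n, IsStdGaussianMatrix μ (G n))
    (hpq : p.HolderConjugate q) (hp2 : p < 2) :
    ∃ u : ℕ → ℝ, Tendsto u atTop (𝓝 (√2 * 2 ^ (-(2 / p)) * gaussMoment q ^ (1 / q))) ∧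
      ∀ᵐ ω ∂μ, ∀ᶠ n in atTop, maxForm p (G n ω) ≤ (n : ℝ) ^ (1 / q) * u n := by
  have hp := hpq.pos
  have hq := two_lt_of_holderConjugate hpq hp2
  have ha : 1 / (8 * q) < 1 / 16 := by
    rw [div_lt_div_iff₀ (by positivity) (by norm_num)]
    linarith
  have hm := gaussMoment_pos (q := q) (by linarith)
  have hmoment : Tendsto (fun n : ℕ => (gaussMoment q + (n : ℝ) ^ (-(1 / 8 : ℝ))) ^ (1 / q)) atTop
      (𝓝 (gaussMoment q ^ (1 / q))) := by
    refine Tendsto.rpow_const ?_ (Or.inl hm.ne')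
    simpa using (tendsto_natCast_rpow_neg (a := 1 / 8) (by norm_num)).const_add (gaussMoment q)
  have hsparse := tendsto_sqrt_log_mul_rpow_neg (a := (1 - 2 * (1 / (8 * q))) / q)
    (div_pos (by linarith) (by linarith)) 6
  have hflat := tendsto_sqrt_log_mul_rpow_neg (a := 1 / (8 * q) / p * (1 - p / 2))
    (mul_pos (by positivity) (by linarith)) 6
  have hround := tendsto_sqrt_log_mul_rpow_neg (a := 1 - 1 / (8 * q)) (by linarith) 6
  have hlim := (hmoment.const_mul (√2 * 2 ^ (-(2 / p)))).add
    (((hsparse.const_mul 4).add (hflat.const_mul (2 / (1 - p / 2)))).add (hround.const_mul 8))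
  simp only [mul_zero, add_zero] at hlim
  refine ⟨_, hlim, ?_⟩
  filter_upwards [ae_eventually_signFormBound_and_sparseImageBound hG hq] with ω hω
  filter_upwards [hω, eventually_ge_atTop 1] with n hgood hn
  exact hgood.1.maxForm_le hpq hp2 hn (by positivity) (by positivity) hgood.2

end Max

/-! ### Quadratic forms at the near optimizers -/

section HolderDual

variable {n : ℕ} {p q : ℝ}

theorem abs_sgn (a : ℝ) : |sgn a| = 1 := by
  unfold sgn
  split_ifs <;> simp

theorem mul_sgn (a : ℝ) : a * sgn a = |a| := by
  unfold sgn
  split_ifs with h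
  · rw [mul_one, abs_of_nonneg h]
  · rw [mul_neg_one, abs_of_neg (not_le.1 h)]

theorem measurable_sgn : Measurable sgn :=
  Measurable.ite measurableSet_Ici measurable_const measurable_const

/-- For Hölder conjugate `p` and `q`, the vector of the `ℓ_p`-unit ball at which the linear form
`⟨b, ·⟩` attains its maximum `‖b‖_q`. It is `0` for `b = 0`. -/
noncomputable def holderDual (p q : ℝ) (b : Fin n → ℝ) : Fin n → ℝ := fun j =>
  sgn (b j) * (|b j| ^ q / normP q b ^ q) ^ (1 / p)

theorem abs_holderDual (b : Fin n → ℝ) (j : Fin n) :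
    |holderDual p q b j| = (|b j| ^ q / normP q b ^ q) ^ (1 / p) := by
  have := normP_nonneg q b
  rw [holderDual, abs_mul, abs_sgn, one_mul, abs_of_nonneg (by positivity)]

theorem normP_holderDual_le_one (hp : 0 < p) (hq : q ≠ 0) (b : Fin n → ℝ) :
    normP p (holderDual p q b) ≤ 1 := by
  have hN := normP_nonneg q b
  have hcoord (j : Fin n) : |holderDual p q b j| ^ p = |b j| ^ q / normP q b ^ q := by
    rw [abs_holderDual, ← Real.rpow_mul (by positivity), one_div_mul_cancel hp.ne', Real.rpow_one]
  have hsum : ∑ j, |holderDual p q b j| ^ p ≤ 1 := by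
    simp only [hcoord, ← Finset.sum_div, normP_rpow hq]
    exact div_self_le_one _
  exact Real.rpow_le_one (Finset.sum_nonneg fun j _ => by positivity) hsum (by positivity)

theorem abs_holderDual_eq_rpow (hpq : p.HolderConjugate q) (b : Fin n → ℝ) (j : Fin n) :
    |holderDual p q b j| = (|b j| / normP q b) ^ (q - 1) := by
  have hN := normP_nonneg q b
  rw [abs_holderDual, ← Real.div_rpow (abs_nonneg _) hN, ← Real.rpow_mul (by positivity),
    mul_one_div, hpq.symm.div_conj_eq_sub_one]

theorem dotProduct_holderDual (hpq : p.HolderConjugate q) (b : Fin n → ℝ) :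
    b ⬝ᵥ holderDual p q b = normP q b := by
  have hcoord (j : Fin n) : b j * holderDual p q b j = |b j| ^ q / normP q b ^ (q - 1) := by
    rw [holderDual, ← mul_assoc, mul_sgn, ← abs_holderDual, abs_holderDual_eq_rpow hpq,
      Real.div_rpow (abs_nonneg _) (normP_nonneg _ _), ← mul_div_assoc]
    congr 1
    rcases (abs_nonneg (b j)).eq_or_lt with h | h
    · rw [← h, zero_mul, Real.zero_rpow hpq.symm.ne_zero]
    · rw [Real.rpow_sub_one h.ne', mul_div_cancel₀ _ h.ne']
  rw [dotProduct, Finset.sum_congr rfl fun j _ => hcoord j, ← Finset.sum_div,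
    ← normP_rpow hpq.symm.ne_zero]
  rcases (normP_nonneg q b).eq_or_lt with h | h
  · rw [← h, Real.zero_rpow hpq.symm.ne_zero, zero_div]
  · rw [← Real.rpow_sub h, sub_sub_cancel, Real.rpow_one]

theorem abs_holderDual_mul_normP_le (hpq : p.HolderConjugate q) (hq : 2 ≤ q) (b : Fin n → ℝ)
    (j : Fin n) : |holderDual p q b j| * normP q b ≤ |b j| := by
  rcases (normP_nonneg q b).eq_or_lt with h | h
  · rw [← h, mul_zero]
    exact abs_nonneg _
  · have hle : |b j| / normP q b ≤ 1 :=
      (div_le_one h).2 (abs_apply_le_normP hpq.symm.pos b j)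
    rw [abs_holderDual_eq_rpow hpq, ← le_div_iff₀ h]
    exact Real.rpow_le_self_of_le_one (by positivity) hle (by linarith)

end HolderDual

section OptVec

variable {n : ℕ} {p q : ℝ} (A : Matrix (Fin n) (Fin n) ℝ)

theorem symMatrix_mulVec_basisVec (i : Fin n) : symMatrix A *ᵥ basisVec i = symMatrix A i := by
  ext j
  simp [symMatrix, basisVec, add_comm, mul_add]

theorem symMatrix_apply_self (i : Fin n) : symMatrix A i i = √2 * A i i := by
  have h : √2 * √2 = 2 := Real.mul_self_sqrt zero_le_two
  rw [symMatrix, Matrix.smul_apply, Matrix.add_apply, Matrix.transpose_apply, smul_eq_mul,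
    inv_mul_eq_iff_eq_mul₀ (by positivity)]
  linear_combination -A i i * h

theorem optVec_eq_holderDual (hpq : p.HolderConjugate q) (i : Fin n) :
    optVec p A i = holderDual p q (symMatrix A i) := by
  ext j
  rw [optVec, holderDual, symMatrix_mulVec_basisVec, hpq.conjugate_eq, Real.conjExponent]

/-- The vector `v_i` with its `i`-th coordinate replaced by `0`. It only depends on the entries of
the `i`-th row and column of `A`, whereas `quadForm A (offVec p A i)` only involves the other
entries. -/
noncomputable def offVec (p : ℝ) (A : Matrix (Fin n) (Fin n) ℝ) (i : Fin n) : Fin n → ℝ :=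
  Function.update (optVec p A i) i 0

theorem basisVec_add_optVec (i : Fin n) :
    basisVec i + optVec p A i = (1 + optVec p A i i) • basisVec i + offVec p A i := by
  ext j
  rcases eq_or_ne j i with rfl | h <;> simp_all [basisVec, offVec]

theorem quadForm_smul (c : ℝ) (x : Fin n → ℝ) : quadForm A (c • x) = c ^ 2 * quadForm A x := by
  simp only [quadForm, Matrix.mulVec_smul, smul_dotProduct, dotProduct_smul, smul_eq_mul]
  ring

theorem quadForm_neg (x : Fin n → ℝ) : quadForm A (-x) = quadForm A x := by
  rw [← neg_one_smul ℝ, quadForm_smul, neg_one_sq, one_mul]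

theorem quadForm_basisVec (i : Fin n) : quadForm A (basisVec i) = A i i := by
  simp [quadForm, basisVec]

theorem offVec_dotProduct_symMatrix (hpq : p.HolderConjugate q) (i : Fin n) :
    offVec p A i ⬝ᵥ symMatrix A i =
      normP q (symMatrix A i) - √2 * optVec p A i i * A i i := by
  have hoff : offVec p A i = optVec p A i - optVec p A i i • basisVec i := by
    rw [eq_sub_iff_add_eq, ← add_right_inj (basisVec i), basisVec_add_optVec]
    module
  rw [hoff, sub_dotProduct, smul_dotProduct, dotProduct_comm, optVec_eq_holderDual A hpq,
    dotProduct_holderDual hpq, basisVec, single_one_dotProduct, symMatrix_apply_self, smul_eq_mul]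
  ring

theorem quadForm_basisVec_add_optVec (hpq : p.HolderConjugate q) (i : Fin n) :
    quadForm A (basisVec i + optVec p A i) = √2 * (1 + optVec p A i i) * normP q (symMatrix A i) +
      (1 - optVec p A i i ^ 2) * A i i + quadForm A (offVec p A i) := by
  have h : √2 * √2 = 2 := Real.mul_self_sqrt zero_le_two
  rw [basisVec_add_optVec, quadForm_add, quadForm_smul, quadForm_basisVec, Matrix.mulVec_smul,
    symMatrix_mulVec_basisVec, dotProduct_smul, offVec_dotProduct_symMatrix A hpq, smul_eq_mul]
  linear_combination (-(1 + optVec p A i i) * optVec p A i i * A i i) * h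

end OptVec

theorem normP_basisVec_add_le {n : ℕ} {p : ℝ} (hp : 0 < p) (i : Fin n) {v : Fin n → ℝ}
    (hv : normP p v ≤ 1) : normP p (basisVec i + v) ≤ 2 ^ (1 / p) * (1 + |v i|) := by
  have hcoord (j : Fin n) :
      |(basisVec i + v) j| ^ p ≤ (if j = i then (1 + |v i|) ^ p else 0) + |v j| ^ p := by
    split_ifs with h
    · subst h
      have : |(basisVec j + v) j| ≤ 1 + |v j| := by
        simpa [basisVec] using abs_add_le 1 (v j)
      exact (Real.rpow_le_rpow (abs_nonneg _) this hp.le).trans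
        (le_add_of_nonneg_right (by positivity))
    · simp [basisVec, h]
  have hsum : normP p (basisVec i + v) ^ p ≤ 2 * (1 + |v i|) ^ p :=
    calc normP p (basisVec i + v) ^ p ≤ (1 + |v i|) ^ p + normP p v ^ p := by
          rw [normP_rpow hp.ne', normP_rpow hp.ne']
          refine (Finset.sum_le_sum fun j _ => hcoord j).trans_eq ?_
          rw [Finset.sum_add_distrib, Finset.sum_ite_eq' _ _, if_pos (Finset.mem_univ _)]
      _ ≤ 2 * (1 + |v i|) ^ p := by
          have h1 : normP p v ^ p ≤ 1 := Real.rpow_le_one (normP_nonneg _ _) hv hp.le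
          have h2 : 1 ≤ (1 + |v i|) ^ p :=
            Real.one_le_rpow (le_add_of_nonneg_right (abs_nonneg _)) hp.le
          linarith
  rw [← Real.rpow_le_rpow_iff (normP_nonneg _ _) (by positivity) hp,
    Real.mul_rpow (by positivity) (by positivity), ← Real.rpow_mul zero_le_two,
    one_div_mul_cancel hp.ne', Real.rpow_one]
  exact hsum

theorem normP_offVec_le_one {n : ℕ} {p q : ℝ} (hpq : p.HolderConjugate q)
    (A : Matrix (Fin n) (Fin n) ℝ) (i : Fin n) : normP p (offVec p A i) ≤ 1 := by
  refine le_trans (normP_mono hpq.nonneg fun j => ?_) <|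
    normP_holderDual_le_one hpq.pos hpq.symm.ne_zero (symMatrix A i)
  rw [← optVec_eq_holderDual A hpq, offVec, Function.update_apply]
  split_ifs <;> simp

section QuadForm

variable {n : ℕ} {p q a : ℝ} {A : Matrix (Fin n) (Fin n) ℝ} {i : Fin n}

theorem abs_optVec_self_mul_normP_le (hpq : p.HolderConjugate q) (hq : 2 ≤ q)
    (hdiag : |A i i| ≤ a) : √2 * (|optVec p A i i| * normP q (symMatrix A i)) ≤ 2 * a := by
  have h : √2 * √2 = 2 := Real.mul_self_sqrt zero_le_two
  rw [optVec_eq_holderDual A hpq]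
  calc √2 * (|holderDual p q (symMatrix A i) i| * normP q (symMatrix A i))
      ≤ √2 * |symMatrix A i i| := by
        gcongr
        exact abs_holderDual_mul_normP_le hpq hq _ _
    _ = 2 * |A i i| := by
        rw [symMatrix_apply_self, abs_mul, abs_of_nonneg (Real.sqrt_nonneg _), ← mul_assoc, h]
    _ ≤ 2 * a := by gcongr

theorem le_quadForm_basisVec_add_optVec (hpq : p.HolderConjugate q) (hq : 2 ≤ q)
    (hdiag : |A i i| ≤ a) (hoff : |quadForm A (offVec p A i)| ≤ a) :
    √2 * normP q (symMatrix A i) - 4 * a ≤ quadForm A (basisVec i + optVec p A i) := by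
  have hself := abs_optVec_self_mul_normP_le hpq hq hdiag
  have hv : |optVec p A i i| ≤ 1 := by
    rw [optVec_eq_holderDual A hpq]
    exact (abs_apply_le_normP hpq.pos _ i).trans
      (normP_holderDual_le_one hpq.pos hpq.symm.ne_zero _)
  have hcross : -(2 * a) ≤ √2 * optVec p A i i * normP q (symMatrix A i) := by
    refine (abs_le.1 (le_trans (le_of_eq ?_) hself)).1
    rw [abs_mul, abs_mul, abs_of_nonneg (Real.sqrt_nonneg _), abs_of_nonneg (normP_nonneg _ _),
      mul_assoc]
  have hdiag' : -a ≤ (1 - optVec p A i i ^ 2) * A i i := by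
    have hsq : optVec p A i i ^ 2 ≤ 1 := (sq_le_one_iff_abs_le_one _).2 hv
    refine (abs_le.1 ((abs_mul _ _).trans_le ((mul_le_of_le_one_left (abs_nonneg _) ?_).trans
      hdiag))).1
    rw [abs_of_nonneg (sub_nonneg.2 hsq)]
    exact sub_le_self _ (sq_nonneg _)
  rw [quadForm_basisVec_add_optVec A hpq]
  linarith [(abs_le.1 hoff).1]

theorem le_quadForm_inv_normP_smul (hpq : p.HolderConjugate q) (hq : 2 ≤ q)
    (hdiag : |A i i| ≤ a) (hoff : |quadForm A (offVec p A i)| ≤ a)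
    (ha : 4 * a < √2 * normP q (symMatrix A i)) :
    2 ^ (-(2 / p)) * (√2 * normP q (symMatrix A i) - 8 * a) ≤
      quadForm A ((normP p (basisVec i + optVec p A i))⁻¹ • (basisVec i + optVec p A i)) := by
  have hself := abs_optVec_self_mul_normP_le hpq hq hdiag
  have hform := le_quadForm_basisVec_add_optVec hpq hq hdiag hoff
  have hnorm : normP p (basisVec i + optVec p A i) ≤ 2 ^ (1 / p) * (1 + |optVec p A i i|) := by
    refine normP_basisVec_add_le hpq.pos i ?_
    rw [optVec_eq_holderDual A hpq]
    exact normP_holderDual_le_one hpq.pos hpq.symm.ne_zero _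
  have hpos : 0 < normP p (basisVec i + optVec p A i) := by
    refine (normP_nonneg _ _).lt_of_ne fun h0 => ?_
    have hzero : basisVec i + optVec p A i = 0 := by
      funext j
      simpa [← h0] using abs_apply_le_normP hpq.pos (basisVec i + optVec p A i) j
    rw [hzero, show quadForm A 0 = 0 by simp [quadForm]] at hform
    linarith
  set s := |optVec p A i i|
  have hs : 0 ≤ s := abs_nonneg _
  have ha0 : 0 ≤ a := (abs_nonneg _).trans hdiag
  have hfactor : 1 - 2 * s ≤ ((1 + s) ^ 2)⁻¹ := by
    rw [← one_div, le_div_iff₀ (by positivity)]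
    nlinarith [pow_nonneg hs 2, pow_nonneg hs 3]
  rw [quadForm_smul]
  calc 2 ^ (-(2 / p)) * (√2 * normP q (symMatrix A i) - 8 * a)
      ≤ 2 ^ (-(2 / p)) * ((1 - 2 * s) * (√2 * normP q (symMatrix A i) - 4 * a)) := by
        gcongr
        linarith [mul_nonneg hs ha0]
    _ ≤ 2 ^ (-(2 / p)) * (((1 + s) ^ 2)⁻¹ * (√2 * normP q (symMatrix A i) - 4 * a)) := by
        gcongr
    _ = (2 ^ (1 / p) * (1 + s))⁻¹ ^ 2 * (√2 * normP q (symMatrix A i) - 4 * a) := by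
        rw [inv_pow, mul_pow, mul_inv, ← Real.rpow_mul_natCast zero_le_two, Nat.cast_ofNat,
          one_div_mul_eq_div, Real.rpow_neg zero_le_two, mul_assoc]
    _ ≤ _ := by gcongr

theorem le_quadForm_of_mem_optSet {R : ℝ} (hpq : p.HolderConjugate q) (hq : 2 ≤ q)
    (hdiag : ∀ i, |A i i| ≤ a) (hoff : ∀ i, |quadForm A (offVec p A i)| ≤ a)
    (hR : ∀ i, R ≤ normP q (symMatrix A i)) (ha : 4 * a < √2 * R) {x : Fin n → ℝ}
    (hx : x ∈ optSet p A) : 2 ^ (-(2 / p)) * (√2 * R - 8 * a) ≤ quadForm A x := by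
  obtain ⟨i, hx⟩ := hx
  have hle : √2 * R ≤ √2 * normP q (symMatrix A i) := by
    gcongr
    exact hR i
  have hquad : quadForm A x =
      quadForm A ((normP p (basisVec i + optVec p A i))⁻¹ • (basisVec i + optVec p A i)) := by
    rcases hx with rfl | rfl
    · rfl
    · rw [quadForm_neg]
  rw [hquad]
  refine le_trans ?_ (le_quadForm_inv_normP_smul hpq hq (hdiag i) (hoff i) (ha.trans_le hle))
  gcongr

end QuadForm

/-! ### Row norms and conditionally Gaussian forms -/

theorem measureReal_prodMk_mem_le_of_indepFun {Ω α β : Type*} [MeasurableSpace Ω]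
    [MeasurableSpace α] [MeasurableSpace β] {μ : Measure Ω} [IsProbabilityMeasure μ] {Y : Ω → α}
    {Z : Ω → β} (hY : Measurable Y) (hZ : Measurable Z) (hYZ : IndepFun Y Z μ) {E : Set (α × β)}
    (hE : MeasurableSet E) {c : ℝ} (h : ∀ y, μ.real {ω | (y, Z ω) ∈ E} ≤ c) :
    μ.real {ω | (Y ω, Z ω) ∈ E} ≤ c := by
  have hc : 0 ≤ c := measureReal_nonneg.trans (h (Y (nonempty_of_isProbabilityMeasure μ).some))
  have := Measure.isProbabilityMeasure_map (μ := μ) hY.aemeasurable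
  refine ENNReal.toReal_le_of_le_ofReal hc ?_
  calc μ {ω | (Y ω, Z ω) ∈ E} = (μ.map Y).prod (μ.map Z) E := by
        rw [← (indepFun_iff_map_prod_eq_prod_map_map hY.aemeasurable hZ.aemeasurable).1 hYZ,
          Measure.map_apply (hY.prodMk hZ) hE]
        rfl
    _ = ∫⁻ y, μ.map Z (Prod.mk y ⁻¹' E) ∂μ.map Y := Measure.prod_apply hE
    _ ≤ ∫⁻ _, ENNReal.ofReal c ∂μ.map Y := by
        refine lintegral_mono fun y => ?_
        rw [Measure.map_apply hZ (measurable_prodMk_left hE)]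
        exact ENNReal.le_ofReal_iff_toReal_le (measure_ne_top _ _) hc |>.2 (h y)
    _ = ENNReal.ofReal c := by simp

section Conditional

variable {Ω ι : Type*} [MeasurableSpace Ω] {μ : Measure Ω} {X : ι → Ω → ℝ}

theorem IsStdGaussianFamily.indepFun_indicator (h : IsStdGaussianFamily μ X)
    {S T : Finset ι} (hST : Disjoint S T) :
    IndepFun (fun ω => (S : Set ι).indicator fun j => X j ω)
      (fun ω => (T : Set ι).indicator fun j => X j ω) μ := by
  classical
  have hext (S : Finset ι) :
      Measurable fun (y : S → ℝ) j => if hj : j ∈ S then y ⟨j, hj⟩ else 0 := by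
    refine measurable_pi_lambda _ fun j => ?_
    split_ifs
    · exact measurable_pi_apply _
    · exact measurable_const
  convert (h.indep.indepFun_finset S T hST h.measurable).comp (hext S) (hext T) using 1 <;>
  · ext ω j
    simp [Set.indicator_apply]

theorem IsStdGaussianFamily.abs_sum_tail_of_dependsOn [Fintype ι] (h : IsStdGaussianFamily μ X)
    {S : Finset ι} {c : (ι → ℝ) → ι → ℝ} (hc : Measurable c) (hcS : DependsOn c S)
    (hc0 : ∀ x, ∀ j ∈ S, c x j = 0) {v : ℝ} (hv : ∀ x, ∑ j, c x j ^ 2 ≤ v) {t : ℝ} (ht : 0 ≤ t) :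
    μ.real {ω | t ≤ |∑ j, c (fun j => X j ω) j * X j ω|} ≤ 2 * Real.exp (-t ^ 2 / (2 * v)) := by
  classical
  have := h.indep.isProbabilityMeasure
  have hmeas (T : Finset ι) : Measurable fun ω => (T : Set ι).indicator fun j => X j ω := by
    refine measurable_pi_lambda _ fun j => ?_
    by_cases hj : j ∈ T
    · simpa [hj] using h.measurable j
    · simp [hj]
  have hsum (x : ι → ℝ) (ω : Ω) :
      ∑ j, c x j * ((↑Sᶜ : Set ι).indicator (fun j => X j ω) j) = ∑ j, c x j * X j ω := by
    refine Finset.sum_congr rfl fun j _ => ?_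
    by_cases hj : j ∈ S <;> simp [hj, hc0]
  have hdep (ω : Ω) : c ((S : Set ι).indicator fun j => X j ω) = c fun j => X j ω :=
    hcS fun j hj => Set.indicator_of_mem hj _
  have hE : MeasurableSet {yz : (ι → ℝ) × (ι → ℝ) | t ≤ |∑ j, c yz.1 j * yz.2 j|} :=
    measurableSet_le measurable_const (by fun_prop)
  have hle := measureReal_prodMk_mem_le_of_indepFun (hmeas S) (hmeas Sᶜ)
    (h.indepFun_indicator disjoint_compl_right) hE fun y => by
      simp only [Set.mem_ofPred_eq, hsum]
      exact h.abs_sum_tail (hv y) ht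
  simpa only [Set.mem_ofPred_eq, hsum, hdep] using hle

end Conditional

section RowRegular

variable {Ω : Type*} [MeasurableSpace Ω] {μ : Measure Ω} {n : ℕ}
  {G : Ω → Matrix (Fin n) (Fin n) ℝ} {p q : ℝ}

theorem measurable_offVec {α : Type*} [MeasurableSpace α] {A : α → Matrix (Fin n) (Fin n) ℝ}
    (hA : ∀ a b, Measurable fun x => A x a b) (i : Fin n) :
    Measurable fun x => offVec p (A x) i := by
  refine measurable_pi_lambda _ fun j => ?_
  rcases eq_or_ne j i with rfl | hj
  · simp [offVec]
  have hsym (l : Fin n) : Measurable fun x => symMatrix (A x) i l :=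
    ((hA i l).add (hA l i)).const_mul _
  have hnorm : Measurable fun x => normP p.conjExponent (symMatrix (A x) i) :=
    (Finset.measurable_fun_sum _ fun l _ => (hsym l).abs.pow_const _).pow_const _
  simp only [offVec, Function.update_of_ne hj, optVec, symMatrix_mulVec_basisVec]
  exact (measurable_sgn.comp (hsym j)).mul
    (((hsym j).abs.pow_const _).div (hnorm.pow_const _) |>.pow_const _)

theorem offVec_congr {A B : Matrix (Fin n) (Fin n) ℝ} {i : Fin n} (hrow : ∀ j, A i j = B i j)
    (hcol : ∀ j, A j i = B j i) : offVec p A i = offVec p B i := by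
  have hsym : symMatrix A i = symMatrix B i := by
    ext j
    simp [symMatrix, hrow, hcol]
  unfold offVec optVec
  simp only [symMatrix_mulVec_basisVec, hsym]

theorem offVec_dotProduct_self_le_one (hpq : p.HolderConjugate q) (hp2 : p ≤ 2)
    (A : Matrix (Fin n) (Fin n) ℝ) (i : Fin n) : offVec p A i ⬝ᵥ offVec p A i ≤ 1 := by
  have hnorm : normP 2 (offVec p A i) ≤ 1 :=
    (normP_antitone_exponent hpq.pos hp2 _).trans (normP_offVec_le_one hpq A i)
  simp only [dotProduct, ← sq]
  rw [← normP_two_sq]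
  exact pow_le_one₀ (normP_nonneg _ _) hnorm

theorem IsStdGaussianMatrix.abs_quadForm_offVec_tail (h : IsStdGaussianMatrix μ G)
    (hpq : p.HolderConjugate q) (hp2 : p ≤ 2) (i : Fin n) {t : ℝ} (ht : 0 ≤ t) :
    μ.real {ω | t ≤ |quadForm (G ω) (offVec p (G ω) i)|} ≤ 2 * Real.exp (-t ^ 2 / 2) := by
  set M : (Fin n × Fin n → ℝ) → Matrix (Fin n) (Fin n) ℝ := fun x => Matrix.of (Function.curry x)
  set c : (Fin n × Fin n → ℝ) → Fin n × Fin n → ℝ := fun x ab =>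
    offVec p (M x) i ab.1 * offVec p (M x) i ab.2
  have hoff : Measurable fun x => offVec p (M x) i :=
    measurable_offVec (fun a b => measurable_pi_apply (a, b)) i
  have hc : Measurable c := measurable_pi_lambda _ fun ab =>
    ((measurable_pi_apply ab.1).comp hoff).mul ((measurable_pi_apply ab.2).comp hoff)
  have htail := h.isStdGaussianFamily.abs_sum_tail_of_dependsOn
    (S := {ab | ab.1 = i ∨ ab.2 = i}) (c := c) (v := 1) hc
    (fun x y hxy => by
      have hM : offVec p (M x) i = offVec p (M y) i :=
        offVec_congr (fun j => hxy (i, j) (by simp)) fun j => hxy (j, i) (by simp)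
      simp only [c, hM])
    (fun x ab hab => by
      rcases (Finset.mem_filter.1 hab).2 with hi | hi <;> simp [c, offVec, hi])
    (fun x => by
      have hle := offVec_dotProduct_self_le_one hpq hp2 (M x) i
      simp only [c, sq, sum_prod_mul_mul]
      exact mul_le_one₀ hle (Finset.sum_nonneg fun j _ => mul_self_nonneg _) hle)
    ht
  rw [mul_one] at htail
  simp only [quadForm_eq_dotProduct, ← sum_prod_mul_apply]
  exact htail

theorem IsStdGaussianMatrix.normP_symMatrix_rpow_tail (h : IsStdGaussianMatrix μ G) (hq : 0 < q)
    (i : Fin n) {s : ℝ} (hs : 0 ≤ s) :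
    μ.real {ω | normP q (symMatrix (G ω) i) ^ q ≤ (n - 1) * gaussMoment q - s} ≤
      Real.exp (-s ^ 2 / (2 * (n * gaussMoment (2 * q)))) := by
  classical
  have := h.indep.isProbabilityMeasure
  have hn : 1 ≤ n := i.pos
  have hcard : Fintype.card {j : Fin n // basisVec i j = 0} = n - 1 := by
    simp [basisVec, Pi.single_apply, Fintype.card_subtype_compl]
  refine (measureReal_mono (fun ω hω => ?_) (measure_ne_top _ _)).trans
    ((h.isStdGaussianFamily_symMatrix_mulVec (u := basisVec i) (by simp [basisVec])
      ).sum_abs_rpow_lower_tail hq.le hn (by rw [hcard]; omega) hs)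
  simp only [Set.mem_ofPred_eq, symMatrix_mulVec_basisVec] at hω ⊢
  rw [hcard, Nat.cast_sub hn, Nat.cast_one]
  refine le_trans ?_ hω
  rw [normP_rpow hq.ne']
  exact (Finset.sum_subtype {j | basisVec i j = 0} (by simp) fun j =>
    |symMatrix (G ω) i j| ^ q).symm.trans_le
      (Finset.sum_le_sum_of_subset_of_nonneg (Finset.subset_univ _) fun j _ _ => by positivity)

/-- The bounds on the `i`-th row and column of `A`, for every `i`, which make `e_i + v_i` a near
optimizer: `a` controls the terms that are negligible in `⟨A (e_i + v_i), e_i + v_i⟩`, and `s` is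
the deviation of `‖Ā e_i‖_q ^ q` below `n - 1` times the Gaussian moment. -/
def RowRegular (p q a s : ℝ) (A : Matrix (Fin n) (Fin n) ℝ) : Prop :=
  ∀ i, |A i i| ≤ a ∧ |quadForm A (offVec p A i)| ≤ a ∧
    (n - 1) * gaussMoment q - s ≤ normP q (symMatrix A i) ^ q

theorem IsStdGaussianMatrix.measureReal_not_rowRegular_le (h : IsStdGaussianMatrix μ G)
    (hpq : p.HolderConjugate q) (hp2 : p ≤ 2) {a s : ℝ} (ha : 0 ≤ a) (hs : 0 ≤ s) :
    μ.real {ω | ¬RowRegular p q a s (G ω)} ≤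
      n * (4 * Real.exp (-a ^ 2 / 2) + Real.exp (-s ^ 2 / (2 * (n * gaussMoment (2 * q))))) := by
  have := h.indep.isProbabilityMeasure
  set E : Fin n → Set Ω := fun i =>
    ({ω | a ≤ |G ω i i|} ∪ {ω | a ≤ |quadForm (G ω) (offVec p (G ω) i)|}) ∪
      {ω | normP q (symMatrix (G ω) i) ^ q ≤ (n - 1) * gaussMoment q - s}
  have hcover : {ω | ¬RowRegular p q a s (G ω)} ⊆ ⋃ i, E i := by
    intro ω hω
    simp only [RowRegular, Set.mem_ofPred_eq, not_forall] at hω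
    obtain ⟨i, hi⟩ := hω
    refine Set.mem_iUnion.2 ⟨i, ?_⟩
    simp only [E, Set.mem_union, Set.mem_ofPred_eq]
    by_contra! hlt
    exact hi ⟨hlt.1.1.le, hlt.1.2.le, hlt.2.le⟩
  have hE (i : Fin n) : μ.real (E i) ≤ 2 * Real.exp (-a ^ 2 / 2) + 2 * Real.exp (-a ^ 2 / 2) +
      Real.exp (-s ^ 2 / (2 * (n * gaussMoment (2 * q)))) := by
    refine (measureReal_union_le _ _).trans (add_le_add ((measureReal_union_le _ _).trans ?_)
      (h.normP_symMatrix_rpow_tail hpq.symm.pos i hs))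
    exact add_le_add (h.isStdGaussianFamily.abs_tail (i, i) ha)
      (h.abs_quadForm_offVec_tail hpq hp2 i ha)
  refine (measureReal_mono hcover (measure_ne_top _ _)).trans
    ((measureReal_iUnion_fintype_le _).trans
      ((Finset.sum_le_card_nsmul _ _ _ fun i _ => hE i).trans_eq ?_))
  rw [Finset.card_univ, Fintype.card_fin, nsmul_eq_mul]
  ring

end RowRegular

/-! ### Lower bound and limit -/

theorem rpow_sub_mul_rpow_le {S U e r : ℝ} (hS : 0 ≤ S) (hU : 0 < U) (h : U - e ≤ S)
    (he : 0 ≤ e) (hr0 : 0 ≤ r) (hr1 : r ≤ 1) : U ^ r - e * U ^ (r - 1) ≤ S ^ r := by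
  rcases le_total U S with hle | hle
  · exact (sub_le_self _ (by positivity)).trans (Real.rpow_le_rpow hU.le hle hr0)
  · calc U ^ r - e * U ^ (r - 1) = (U - e) * U ^ (r - 1) := by
          rw [Real.rpow_sub_one hU.ne']
          field_simp
      _ ≤ S * U ^ (r - 1) := by gcongr
      _ = U ^ r * (S / U) := by
          rw [Real.rpow_sub_one hU.ne']
          ring
      _ ≤ U ^ r * (S / U) ^ r := by
          gcongr
          exact Real.self_le_rpow_of_le_one (by positivity) ((div_le_one hU).2 hle) hr1
      _ = S ^ r := by rw [← Real.mul_rpow hU.le (by positivity), mul_div_cancel₀ _ hU.ne']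

section Limit

variable {p q : ℝ}

theorem RowRegular.normP_symMatrix_ge {n : ℕ} {a K L : ℝ} {A : Matrix (Fin n) (Fin n) ℝ}
    (hpq : p.HolderConjugate q) (hq : 2 ≤ q) (hK : 0 ≤ K) (hL : 1 ≤ L)
    (h : RowRegular p q a (K * L * √n) A) (i : Fin n) :
    (n * gaussMoment q) ^ (1 / q) -
      (gaussMoment q + K) * gaussMoment q ^ (1 / q - 1) * L ≤ normP q (symMatrix A i) := by
  have hq0 := hpq.symm.pos
  have hm : 0 < gaussMoment q := gaussMoment_pos hq0.le
  have hn : (1 : ℝ) ≤ n := by exact_mod_cast i.pos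
  have hsqrt : 1 ≤ √(n : ℝ) := Real.one_le_sqrt.2 hn
  have hdev : n * gaussMoment q - (gaussMoment q + K) * L * √n ≤ normP q (symMatrix A i) ^ q := by
    have : gaussMoment q * 1 ≤ gaussMoment q * (L * √n) := by
      gcongr
      exact one_le_mul_of_one_le_of_one_le hL hsqrt
    linarith [(h i).2.2]
  have hrpow := rpow_sub_mul_rpow_le (r := 1 / q) (Real.rpow_nonneg (normP_nonneg _ _) _)
    (by positivity) hdev (by positivity) (by positivity) (by rw [div_le_one hq0]; linarith)
  rw [← Real.rpow_mul (normP_nonneg _ _), mul_one_div_cancel hq0.ne', Real.rpow_one] at hrpow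
  have hexp : √(n : ℝ) * (n : ℝ) ^ (1 / q - 1) ≤ 1 := by
    rw [Real.sqrt_eq_rpow, ← Real.rpow_add (by linarith)]
    refine Real.rpow_le_one_of_one_le_of_nonpos hn ?_
    have : 1 / q ≤ 1 / 2 := one_div_le_one_div_of_le two_pos hq
    linarith
  refine le_trans (sub_le_sub_left ?_ _) hrpow
  calc _ = (gaussMoment q + K) * gaussMoment q ^ (1 / q - 1) * L * (√n * n ^ (1 / q - 1)) := by
        rw [Real.mul_rpow (by linarith) hm.le]
        ring
    _ ≤ _ := mul_le_of_le_one_right (by positivity) hexp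

theorem exists_eventually_le_quadForm_of_rowRegular (hpq : p.HolderConjugate q) (hp2 : p < 2)
    {b K : ℝ} (hb : 0 ≤ b) (hK : 0 ≤ K) : ∃ C : ℝ, 0 < C ∧ ∀ᶠ n : ℕ in atTop,
      ∀ A : Matrix (Fin n) (Fin n) ℝ,
        RowRegular p q (b * √(Real.log n)) (K * √(Real.log n) * √n) A → ∀ x ∈ optSet p A,
          √2 * 2 ^ (-(2 / p)) * gaussMoment q ^ (1 / q) * n ^ (1 / q) - C * √(Real.log n) ≤
            quadForm A x := by
  have hq0 := hpq.symm.pos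
  have hq2 := two_lt_of_holderConjugate hpq hp2
  have hm : 0 < gaussMoment q := gaussMoment_pos hq0.le
  set D := (gaussMoment q + K) * gaussMoment q ^ (1 / q - 1)
  have hlim := (tendsto_sqrt_log_mul_rpow_neg (a := 1 / q) (by positivity) 1).const_mul
    (4 * b + √2 * D)
  rw [mul_zero] at hlim
  refine ⟨2 ^ (-(2 / p)) * (√2 * D + 8 * b), by positivity, ?_⟩
  filter_upwards [eventually_ge_atTop 3,
    hlim.eventually_lt_const (show 0 < √2 * gaussMoment q ^ (1 / q) by positivity)] with
    n hn hsmall A hA x hx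
  have hn0 : (0 : ℝ) < n := by positivity
  have hL : 1 ≤ √(Real.log n) := by
    rw [Real.one_le_sqrt, Real.le_log_iff_exp_le hn0]
    exact (Real.exp_one_lt_d9.trans (by norm_num)).le.trans (Nat.ofNat_le_cast.2 hn)
  rw [one_mul, Real.rpow_neg hn0.le, ← mul_assoc, ← div_eq_mul_inv, div_lt_iff₀ (by positivity)]
    at hsmall
  refine le_trans (le_of_eq ?_) (le_quadForm_of_mem_optSet hpq hq2.le (fun i => (hA i).1)
    (fun i => (hA i).2.1) (hA.normP_symMatrix_ge hpq hq2.le hK hL) ?_ hx)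
  · rw [Real.mul_rpow hn0.le hm.le]
    ring
  · rw [Real.mul_rpow hn0.le hm.le]
    linarith

theorem IsStdGaussianMatrix.measureReal_not_rowRegular_log_le {Ω : Type*} [MeasurableSpace Ω]
    {μ : Measure Ω} {n : ℕ} {G : Ω → Matrix (Fin n) (Fin n) ℝ} (h : IsStdGaussianMatrix μ G)
    (hpq : p.HolderConjugate q) (hp2 : p ≤ 2) (hn : 1 ≤ n) {b : ℝ} (hb : 0 ≤ b) :
    μ.real {ω | ¬RowRegular p q (√(2 * b) * √(Real.log n))
      (√(2 * b * gaussMoment (2 * q)) * √(Real.log n) * √n) (G ω)} ≤ 5 * (n : ℝ) ^ (1 - b) := by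
  have hM : 0 < gaussMoment (2 * q) := gaussMoment_pos (mul_pos two_pos hpq.symm.pos).le
  have hn0 : (0 : ℝ) < n := by exact_mod_cast hn
  have hlog : 0 ≤ Real.log n := Real.log_natCast_nonneg n
  have hexp : Real.exp (-(b * Real.log n)) = (n : ℝ) ^ (-b) := by
    rw [Real.rpow_def_of_pos hn0]
    congr 1
    ring
  have ha : -(√(2 * b) * √(Real.log n)) ^ 2 / 2 = -(b * Real.log n) := by
    rw [mul_pow, Real.sq_sqrt (by positivity), Real.sq_sqrt hlog]
    ring
  have hs : -(√(2 * b * gaussMoment (2 * q)) * √(Real.log n) * √n) ^ 2 /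
      (2 * (n * gaussMoment (2 * q))) = -(b * Real.log n) := by
    rw [mul_pow, mul_pow, Real.sq_sqrt (by positivity), Real.sq_sqrt hlog, Real.sq_sqrt hn0.le]
    field_simp
  refine (h.measureReal_not_rowRegular_le hpq hp2 (by positivity) (by positivity)).trans_eq ?_
  rw [ha, hs, hexp, sub_eq_add_neg, Real.rpow_add hn0, Real.rpow_one]
  ring

theorem exists_measureReal_not_forall_optSet_le (hpq : p.HolderConjugate q) (hp2 : p < 2) {d : ℝ}
    (hd : 0 < d) :
    ∃ C : ℝ, 0 < C ∧ ∀ (Ω : Type*) [MeasurableSpace Ω] (μ : Measure Ω) (n : ℕ) (_ : 1 ≤ n)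
      (G : Ω → Matrix (Fin n) (Fin n) ℝ), IsStdGaussianMatrix μ G →
        μ.real {ω | ¬∀ x ∈ optSet p (G ω),
          √2 * 2 ^ (-(2 / p)) * gaussMoment q ^ (1 / q) * n ^ (1 / q) - C * √(Real.log n) ≤
            quadForm (G ω) x} ≤ C * (n : ℝ) ^ (-d) := by
  obtain ⟨C, hC, hev⟩ := exists_eventually_le_quadForm_of_rowRegular hpq hp2
    (Real.sqrt_nonneg (2 * (d + 1))) (Real.sqrt_nonneg (2 * (d + 1) * gaussMoment (2 * q)))
  obtain ⟨N, hN⟩ := eventually_atTop.1 hev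
  refine ⟨C + 5 + (N : ℝ) ^ d, by positivity, fun Ω _ μ n hn G hG => ?_⟩
  have := hG.indep.isProbabilityMeasure
  have hn0 : (0 : ℝ) < n := by exact_mod_cast hn
  rcases lt_or_ge n N with hlt | hge
  · refine measureReal_le_one.trans ?_
    have hle : (n : ℝ) ^ d ≤ C + 5 + (N : ℝ) ^ d :=
      (Real.rpow_le_rpow hn0.le (Nat.cast_le.2 hlt.le) hd.le).trans
        (le_add_of_nonneg_left (by positivity))
    rwa [Real.rpow_neg hn0.le, ← div_eq_mul_inv, one_le_div (by positivity)]
  · have hfail := hG.measureReal_not_rowRegular_log_le hpq hp2.le hn (b := d + 1) (by positivity)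
    rw [sub_add_cancel_right] at hfail
    have hNd := Real.rpow_nonneg (Nat.cast_nonneg (α := ℝ) N) d
    refine (measureReal_mono (s₂ := {ω | ¬RowRegular p q _ _ (G ω)}) (fun ω hω hreg => ?_)
      (measure_ne_top _ _)).trans (hfail.trans ?_)
    · refine hω fun x hx => le_trans ?_ (hN n hge _ hreg x hx)
      gcongr
      linarith
    · gcongr
      linarith

theorem le_maxForm_of_mem_optSet (hp : 1 ≤ p) {n : ℕ} {A : Matrix (Fin n) (Fin n) ℝ}
    {x : Fin n → ℝ} (hx : x ∈ optSet p A) (hpos : 0 < quadForm A x) :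
    quadForm A x ≤ maxForm p A := by
  have hp0 : 0 < p := by linarith
  have hx0 : x ≠ 0 := by
    rintro rfl
    simp [quadForm] at hpos
  obtain ⟨i, hi⟩ := hx
  refine (isGreatest_maxForm hp i.pos A).2 ⟨x, ?_, rfl⟩
  have hne : normP p (basisVec i + optVec p A i) ≠ 0 := by
    intro h
    rw [h, inv_zero, zero_smul, neg_zero, or_self] at hi
    exact hx0 hi
  have hnorm : normP p x =
      (normP p (basisVec i + optVec p A i))⁻¹ * normP p (basisVec i + optVec p A i) := by
    rcases hi with rfl | rfl
    · rw [normP_smul hp0, abs_of_nonneg (inv_nonneg.2 (normP_nonneg _ _))]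
    · rw [← neg_smul, normP_smul hp0, abs_neg, abs_of_nonneg (inv_nonneg.2 (normP_nonneg _ _))]
  exact hnorm.trans (inv_mul_cancel₀ hne)

theorem exists_tendsto_ae_eventually_le_maxForm {Ω : Type*} [MeasurableSpace Ω] {μ : Measure Ω}
    {G : (n : ℕ) → Ω → Matrix (Fin n) (Fin n) ℝ} (hG : ∀ n, IsStdGaussianMatrix μ (G n))
    (hpq : p.HolderConjugate q) (hp2 : p < 2) :
    ∃ l : ℕ → ℝ, Tendsto l atTop (𝓝 (√2 * 2 ^ (-(2 / p)) * gaussMoment q ^ (1 / q))) ∧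
      ∀ᵐ ω ∂μ, ∀ᶠ n : ℕ in atTop, (n : ℝ) ^ (1 / q) * l n ≤ maxForm p (G n ω) := by
  have := (hG 0).indep.isProbabilityMeasure
  have hq := hpq.symm.pos
  have hm := gaussMoment_pos hq.le
  obtain ⟨C, -, hfail⟩ := exists_measureReal_not_forall_optSet_le hpq hp2 two_pos
  have hlim := ((tendsto_sqrt_log_mul_rpow_neg (a := 1 / q) (by positivity) 1).const_mul
    C).const_sub (√2 * 2 ^ (-(2 / p)) * gaussMoment q ^ (1 / q))
  rw [mul_zero, sub_zero] at hlim
  refine ⟨_, hlim, ?_⟩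
  filter_upwards [ae_eventually_notMem_of_measureReal_le (s := -2) (by norm_num) <|
    (eventually_ge_atTop 1).mono fun n hn => hfail Ω μ n hn (G n) (hG n)] with ω hω
  filter_upwards [hω, eventually_ge_atTop 1,
    hlim.eventually_const_lt (show 0 < √2 * 2 ^ (-(2 / p)) * gaussMoment q ^ (1 / q) by positivity)]
    with n hgood hn hpos
  have hn0 : (0 : ℝ) < n := by exact_mod_cast hn
  have hle := not_not.1 hgood _ ⟨⟨0, hn⟩, Or.inl rfl⟩
  have hscale : √2 * 2 ^ (-(2 / p)) * gaussMoment q ^ (1 / q) * n ^ (1 / q) - C * √(Real.log n) =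
      n ^ (1 / q) * (√2 * 2 ^ (-(2 / p)) * gaussMoment q ^ (1 / q) -
        C * (√(1 * Real.log n) * n ^ (-(1 / q)))) := by
    rw [one_mul, Real.rpow_neg hn0.le]
    field_simp
  rw [hscale] at hle
  exact hle.trans (le_maxForm_of_mem_optSet hpq.lt.le ⟨⟨0, hn⟩, Or.inl rfl⟩
    ((mul_pos (by positivity) hpos).trans_le hle))

theorem ae_tendsto_maxForm {Ω : Type*} [MeasurableSpace Ω] {μ : Measure Ω}
    {G : (n : ℕ) → Ω → Matrix (Fin n) (Fin n) ℝ} (hG : ∀ n, IsStdGaussianMatrix μ (G n))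
    (hpq : p.HolderConjugate q) (hp2 : p < 2) :
    ∀ᵐ ω ∂μ, Tendsto (fun n : ℕ => 1 / (n : ℝ) ^ (1 / q) * maxForm p (G n ω)) atTop
      (𝓝 (√2 * 2 ^ (-(2 / p)) * gaussMoment q ^ (1 / q))) := by
  have := (hG 0).indep.isProbabilityMeasure
  obtain ⟨l, hl, hlower⟩ := exists_tendsto_ae_eventually_le_maxForm hG hpq hp2
  obtain ⟨u, hu, hupper⟩ := exists_tendsto_ae_eventually_maxForm_le hG hpq hp2
  filter_upwards [hlower, hupper] with ω hlω huω
  refine tendsto_of_tendsto_of_tendsto_of_le_of_le' hl hu ?_ ?_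
  · filter_upwards [hlω, eventually_gt_atTop 0] with n hn hn0
    rwa [one_div_mul_eq_div, le_div_iff₀' (by positivity)]
  · filter_upwards [huω, eventually_gt_atTop 0] with n hn hn0
    rwa [one_div_mul_eq_div, div_le_iff₀' (by positivity)]

theorem two_rpow_half_sub_mul_xi (p q : ℝ) :
    (2 : ℝ) ^ ((1 : ℝ) / 2 - 2 / p) * xi q = √2 * 2 ^ (-(2 / p)) * gaussMoment q ^ (1 / q) := by
  rw [sub_eq_add_neg, Real.rpow_add two_pos, ← Real.sqrt_eq_rpow]
  rfl

theorem one_sub_measureReal_not_le {Ω : Type*} [MeasurableSpace Ω] {μ : Measure Ω}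
    [IsProbabilityMeasure μ] (P : Ω → Prop) : 1 - μ.real {ω | ¬P ω} ≤ μ.real {ω | P ω} := by
  rw [sub_le_iff_le_add, ← probReal_univ (μ := μ), ← Set.union_compl_self {ω | P ω}]
  exact measureReal_union_le _ _

end Limit

end LpGrothendieck

theorem theorem1p2 (p : ℝ) (hp1 : 1 < p) (hp2 : p < 2) :
    -- (i) almost sure convergence of the scaled maximum
    (∀ (Ω : Type*) [MeasurableSpace Ω] (μ : Measure Ω) [IsProbabilityMeasure μ]
        (G : (n : ℕ) → Ω → Matrix (Fin n) (Fin n) ℝ),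
        (∀ n, LpGrothendieck.IsStdGaussianMatrix μ (G n)) →
        ∀ᵐ ω ∂μ, Tendsto
          (fun n : ℕ => 1 / (n : ℝ) ^ (1 / p.conjExponent) * LpGrothendieck.maxForm p (G n ω))
          atTop
          (𝓝 ((2 : ℝ) ^ ((1 : ℝ) / 2 - 2 / p) * LpGrothendieck.xi p.conjExponent))) ∧
    -- (ii) every vector of the explicit set is a near optimizer
    (∀ d : ℝ, 0 < d → ∃ C : ℝ, 0 < C ∧
      ∀ (Ω : Type*) [MeasurableSpace Ω] (μ : Measure Ω) [IsProbabilityMeasure μ]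
        (n : ℕ) (_ : 1 ≤ n) (G : Ω → Matrix (Fin n) (Fin n) ℝ),
        LpGrothendieck.IsStdGaussianMatrix μ G →
        1 - C * (n : ℝ) ^ (-d) ≤
          μ.real {ω | ∀ x ∈ LpGrothendieck.optSet p (G ω),
            (2 : ℝ) ^ ((1 : ℝ) / 2 - 2 / p) * LpGrothendieck.xi p.conjExponent *
                (n : ℝ) ^ (1 / p.conjExponent) -
              C * ((n : ℝ) ^ (-(1 / p) + 1 / 2 + 1 / p.conjExponent) *
                    Real.log n ^ (p.conjExponent / 4) + √(Real.log n)) ≤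
              LpGrothendieck.quadForm (G ω) x}) := by
  have hpq := Real.HolderConjugate.conjExponent hp1
  simp only [LpGrothendieck.two_rpow_half_sub_mul_xi]
  refine ⟨fun Ω _ μ _ G hG => LpGrothendieck.ae_tendsto_maxForm hG hpq hp2, fun d hd => ?_⟩
  obtain ⟨C, hC, hfail⟩ := LpGrothendieck.exists_measureReal_not_forall_optSet_le hpq hp2 hd
  refine ⟨C, hC, fun Ω _ μ _ n hn G hG => (sub_le_sub_left (hfail Ω μ n hn G hG) 1).trans
    ((LpGrothendieck.one_sub_measureReal_not_le _).trans (measureReal_mono ?_))⟩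
  intro ω hω x hx
  refine le_trans (sub_le_sub_left (mul_le_mul_of_nonneg_left ?_ hC.le) _) (hω x hx)
  have := Real.log_natCast_nonneg n
  exact le_add_of_nonneg_left (by positivity)
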